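/- **Setting.** An instance of vertex-weighted online bipartite fractional matching with advice is a finite bipartite graph $G=(U\cup V,E)$ with weights $w_u\ge 0$ for the offline vertices $u\in U$, known in advance. The online vertices $v\in V$ arrive one by one; when $v$ arrives, its neighbourhood $N(v)\subseteq U$ and advice values $a_{u,v}$, $u\in N(v)$, are revealed, where $a=(a_{u,v})_{(u,v)\in E}$ is a feasible fractional matching of $G$ (nonnegative, $\sum_{v\in N(u)}a_{u,v}\le 1$ for all $u\in U$, $\sum_{u\in N(v)}a_{u,v}\le 1$ for all $v\in V$). The algorithm then irrevocably chooses $x_{u,v}\ge 0$, $u\in N(v)$, so that $x$ remains a feasible fractional matching. Let $\mathsf{ALG}=\sum_{(u,v)\in E}w_ux_{u,v}$, $\mathsf{ADVICE}=\sum_{(u,v)\in E}w_ua_{u,v}$, and let $\mathsf{OPT}$ be the maximum weight of a fractional matching of $G$. For $r,c\in[0,1]$, a deterministic algorithm is $r$-robust if $\mathsf{ALG}\ge r\cdot\mathsf{OPT}$ on every instance and $c$-consistent if $\mathsf{ALG}\ge c\cdot\mathsf{ADVICE}$ on every instance. **Algorithm.** Let $\lambda\in[0,1]$, and let $W$ be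 the principal branch of the Lambert function, i.e. the inverse of $y\mapsto ye^y$ on $[-1,\infty)$. For $z\in[0,1]$ put $f_0(z)=\min\{e^{z+\lambda-1},1\}$ and $$f_1(z)=\begin{cases}\dfrac{e^{\lambda-1}-\lambda}{1-z}, & z\in[0,\lambda e^{1-\lambda}),\\[2mm] \dfrac{-\lambda}{W(-\lambda e^{1-\lambda-z})}, & z\in[\lambda e^{1-\lambda},1),\\[2mm] 1,& z=1,\end{cases}$$ where for $\lambda=0$ the second expression is read as its limit $e^{z-1}$. For $A,X\in[0,1]$ put $f(A,X)=f_1(X)$ if $A>X$, and $f(A,X)=\max\{f_0(X-A),f_1(X)\}$ if $A\le X$. LearningAugmentedBalance keeps fill levels $X_u$ and advice loads $A_u$, initially $0$. When $v$ arrives, it first adds $a_{u,v}$ to $A_u$ for each $u\in N(v)$. For $\ell\ge0$ and $u\in N(v)$ let $$x_{u,v}(\ell)=\min\{z\in[0,1-X_u] : w_u(1-f(A_u,X_u+z))\le\ell\}.$$ It takes the smallest $\ell\ge0$ with $\sum_{u\in N(v)}x_{u,v}(\ell)\le1$, sets $x_{u,v}=x_{u,v}(\ell)$ and adds $x_{u,v}$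 to $X_u$ for each $u\in N(v)$. **Theorem.** For every $\lambda\in[0,1]$, LearningAugmentedBalance is a well-defined online algorithm for vertex-weighted online bipartite fractional matching with fractional advice (all the minima above exist, its output is always a feasible fractional matching, and its decision at each arrival depends only on the offline weights and on what has been revealed so far). It is $r(\lambda)$-robust and $c(\lambda)$-consistent, where $$r(\lambda)=1-e^{\lambda-1}-(e^{\lambda-1}-\lambda)\ln(1-\lambda e^{1-\lambda})-\lambda(1-\lambda),\qquad c(\lambda)=1+\lambda-e^{\lambda-1},$$ and for $\lambda=1$ the product $(e^{\lambda-1}-\lambda)\ln(1-\lambda e^{1-\lambda})$ is read as its limit $0$. -/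

import Mathlib

/-! Vertex-weighted online bipartite fractional matching with advice, and the algorithm
LearningAugmentedBalance. -/

universe u

noncomputable section

namespace OBM

/-! ### Instances, fractional matchings, online algorithms -/

/-- A vertex-weighted instance with offline vertices `U` and online vertices `0, …, n - 1`,
which arrive in this order: the edge relation and the nonnegative offline weights. -/
structure Instance (U : Type u) (n : ℕ) where
  E : U → Fin n → Prop
  w : U → ℝ
  w_nonneg : ∀ u, 0 ≤ w u

/-- A feasible fractional matching of the graph, extended by zero to the non-edges. -/
structure IsFractionalMatching {U : Type u} [Fintype U] {n : ℕ} (I : Instance U n) (x : U → Fin n → ℝ) : Prop where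
  nonneg : ∀ u v, 0 ≤ x u v
  off_edges : ∀ u v, ¬ I.E u v → x u v = 0
  offline_le : ∀ u, ∑ v, x u v ≤ 1
  online_le : ∀ v, ∑ u, x u v ≤ 1

/-- The weight of a fractional matching. -/
def value {U : Type u} [Fintype U] {n : ℕ} (I : Instance U n) (x : U → Fin n → ℝ) : ℝ := ∑ u, ∑ v, I.w u * x u v

/-- The maximum weight of a fractional matching in the hindsight graph. -/
def opt {U : Type u} [Fintype U] {n : ℕ} (I : Instance U n) : ℝ := sSup {r | ∃ x, IsFractionalMatching I x ∧ r = value I x}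

/-- A deterministic map from instances with advice to candidate solutions. -/
def Algorithm : Type (u + 1) :=
  ∀ (U : Type u) [Fintype U] (n : ℕ), Instance U n → (U → Fin n → ℝ) → U → Fin n → ℝ

/-- The algorithm always outputs a feasible fractional matching, and the amounts allocated at the
`i`-th arrival depend only on the offline weights and on the neighbourhoods and advice of the
arrivals up to and including the `i`-th. -/
def IsOnlineMatchingAlgorithm (alg : Algorithm.{u}) : Prop :=
  (∀ (U : Type u) [Fintype U] (n : ℕ) (I : Instance U n) (a : U → Fin n → ℝ),
    IsFractionalMatching I a → IsFractionalMatching I (alg U n I a)) ∧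
  (∀ (U : Type u) [Fintype U] (n m : ℕ) (I : Instance U n) (J : Instance U m)
    (a : U → Fin n → ℝ) (b : U → Fin m → ℝ),
    IsFractionalMatching I a → IsFractionalMatching J b → I.w = J.w →
    ∀ (i : ℕ) (hn : i < n) (hm : i < m),
      (∀ (j : ℕ) (hj : j ≤ i) (u : U),
        (I.E u ⟨j, hj.trans_lt hn⟩ ↔ J.E u ⟨j, hj.trans_lt hm⟩) ∧
          a u ⟨j, hj.trans_lt hn⟩ = b u ⟨j, hj.trans_lt hm⟩) →
      ∀ u, alg U n I a u ⟨i, hn⟩ = alg U m J b u ⟨i, hm⟩)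

/-- `r`-robustness: `ALG ≥ r · OPT` on every instance, whatever the advice. -/
def IsRobust (alg : Algorithm.{u}) (r : ℝ) : Prop :=
  r ∈ Set.Icc (0 : ℝ) 1 ∧
  ∀ (U : Type u) [Fintype U] (n : ℕ) (I : Instance U n) (a : U → Fin n → ℝ),
    IsFractionalMatching I a → r * opt I ≤ value I (alg U n I a)

/-- `c`-consistency: `ALG ≥ c · ADVICE` on every instance. -/
def IsConsistent (alg : Algorithm.{u}) (c : ℝ) : Prop :=
  c ∈ Set.Icc (0 : ℝ) 1 ∧
  ∀ (U : Type u) [Fintype U] (n : ℕ) (I : Instance U n) (a : U → Fin n → ℝ),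
    IsFractionalMatching I a → c * value I a ≤ value I (alg U n I a)

/-! ### The penalty function -/

/-- Principal branch of the Lambert function: the inverse of `y ↦ y * exp y` on `[-1, ∞)`
(only used on `[-1/e, ∞)`). -/
def lambertW : ℝ → ℝ := Function.invFunOn (fun y : ℝ => y * Real.exp y) (Set.Ici (-1))

def f0 (lam z : ℝ) : ℝ := min (Real.exp (z + lam - 1)) 1

/-- For `lam = 0` the quotient `-lam / W(-lam * exp (1 - lam - z))` reads `0 / 0`; there it stands
for its limit `exp (z - 1)` as `lam → 0`. -/
def f1 (lam z : ℝ) : ℝ :=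
  if z = 1 then 1
  else if z < lam * Real.exp (1 - lam) then (Real.exp (lam - 1) - lam) / (1 - z)
  else if lam = 0 then Real.exp (z - 1)
  else -lam / lambertW (-lam * Real.exp (1 - lam - z))

/-- The advice-dependent penalty. -/
def penalty (lam A X : ℝ) : ℝ :=
  if X < A then f1 lam X else max (f0 lam (X - A)) (f1 lam X)

/-! ### LearningAugmentedBalance -/

/-- Amounts `z` after which an offline vertex of weight `w`, advice load `A` and fill level `X`
has potential at most `l`. -/
def fillSet (lam w A X l : ℝ) : Set ℝ :=
  {z | z ∈ Set.Icc 0 (1 - X) ∧ w * (1 - penalty lam A (X + z)) ≤ l}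

open Classical in
/-- The allocation at potential level `l`: each neighbour receives the least amount that brings its
potential down to at most `l`. -/
def allocAt {U : Type u} (lam : ℝ) (w : U → ℝ) (N : Set U) (A X : U → ℝ) (l : ℝ) (u : U) : ℝ :=
  if u ∈ N then sInf (fillSet lam (w u) (A u) (X u) l) else 0

/-- The nonnegative levels at which at most one unit is allocated in total. -/
def levelSet {U : Type u} [Fintype U] (lam : ℝ) (w : U → ℝ) (N : Set U) (A X : U → ℝ) : Set ℝ :=
  {l | 0 ≤ l ∧ ∑ u, allocAt lam w N A X l u ≤ 1}

/-- One arrival with neighbourhood `N`: allocate at the smallest admissible level. -/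
def labStep {U : Type u} [Fintype U] (lam : ℝ) (w : U → ℝ) (N : Set U) (A X : U → ℝ) : U → ℝ :=
  allocAt lam w N A X (sInf (levelSet lam w N A X))

/-- Total advice given to `u` by the first `k` arrivals. -/
def adviceLoad {U : Type u} {n : ℕ} (a : U → Fin n → ℝ) (k : ℕ) (u : U) : ℝ :=
  ∑ v ∈ Finset.univ.filter (fun v : Fin n => (v : ℕ) < k), a u v

/-- Fill levels of the offline vertices after the first `k` arrivals. -/
def labLoad {U : Type u} [Fintype U] {n : ℕ} (lam : ℝ) (I : Instance U n)
    (a : U → Fin n → ℝ) : ℕ → U → ℝ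
  | 0 => fun _ => 0
  | k + 1 => fun u => labLoad lam I a k u +
      if h : k < n then
        labStep lam I.w {u' | I.E u' ⟨k, h⟩} (adviceLoad a (k + 1)) (labLoad lam I a k) u
      else 0

/-- LearningAugmentedBalance with tradeoff parameter `lam`. -/
def LAB (lam : ℝ) : Algorithm.{u} := fun _ _ _ I a u v =>
  labStep lam I.w {u' | I.E u' v} (adviceLoad a (v + 1)) (labLoad lam I a v) u

/-- In every run of LearningAugmentedBalance the infima in its definition are minima. -/
def LABWellDefined (lam : ℝ) : Prop :=
  ∀ (U : Type u) [Fintype U] (n : ℕ) (I : Instance U n) (a : U → Fin n → ℝ),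
    IsFractionalMatching I a → ∀ v : Fin n,
      (∀ u, I.E u v → ∀ l : ℝ, 0 ≤ l →
        IsLeast (fillSet lam (I.w u) (adviceLoad a (v + 1) u) (labLoad lam I a v u) l)
          (sInf (fillSet lam (I.w u) (adviceLoad a (v + 1) u) (labLoad lam I a v u) l))) ∧
      IsLeast (levelSet lam I.w {u | I.E u v} (adviceLoad a (v + 1)) (labLoad lam I a v))
        (sInf (levelSet lam I.w {u | I.E u v} (adviceLoad a (v + 1)) (labLoad lam I a v)))

/-! ### The guarantees -/

def robustness (lam : ℝ) : ℝ :=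
  1 - Real.exp (lam - 1)
    - (Real.exp (lam - 1) - lam) * Real.log (1 - lam * Real.exp (1 - lam)) - lam * (1 - lam)

def consistency (lam : ℝ) : ℝ := 1 + lam - Real.exp (lam - 1)

end OBM

end

noncomputable section

namespace OBM

/-! ### The function `f1` -/

/-! Write `b = exp (lam - 1)`, let `l v` be the level used at `v`, and first take `lam < 1`.
Right-continuity of the penalty makes the infima attained. Strict monotonicity, as long as the
penalty is below 1, gives complementary slackness: `l v > 0` only if `v` is fully matched
(`labLevel_mul_sum`). Hence `ALG` splits into `l v` for each online vertex and `∑ v, (w - l v) * x u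
v` for each offline vertex. If a fill level really rises, `w - l v` is at least `w` times the left
limit of the penalty at the new level. If an offline vertex is a neighbour, `w - l v` is at most `w`
times the new penalty. Everything is charged through these two bounds.

Robustness is approximate dual feasibility (`robustness_mul_weight_le`). The share collected by `u`
up to the arrival of a neighbour is bounded below by two potentials. `f1Potential`, an
antiderivative of `f1`, handles the case where `f1` determines the penalty and yields exactly
`robustness lam`. `slopePotential`, which integrates `f0`, handles the other case and yields `1 -
b`, which is no smaller (`robustness_le`).

Consistency is proved separately for each offline vertex by telescoping `lossPotential`, a function
of `g = f1 X` and of the excess `D = X - A`. It decreases in `g` and is convex in `D`, and its slope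
in `D` is the penalty. So one arrival changes it, times `w`, by at most `(w - l v)` times the change
of `D`, whatever the sign of that change (`IsArrivalStep.lossPotential_sub_le`). It starts at `b -
lam` and ends at no less than `(b - lam) * (1 - A)` (`le_lossPotential`); the defining equations of
both branches of `f1` are what make this final bound work.

For `lam = 1` the penalty is a threshold at the advice load, and the algorithm copies the advice on
vertices of positive weight. -/

lemma self_le_exp_sub_one (lam : ℝ) : lam ≤ Real.exp (lam - 1) := by
  linarith [Real.add_one_le_exp (lam - 1)]

lemma self_lt_exp_sub_one {lam : ℝ} (h1 : lam < 1) : lam < Real.exp (lam - 1) := by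
  linarith [Real.add_one_lt_exp (sub_ne_zero.2 h1.ne)]

lemma mul_exp_one_sub (lam : ℝ) : lam * Real.exp (1 - lam) = lam / Real.exp (lam - 1) := by
  rw [div_eq_mul_inv, ← Real.exp_neg, neg_sub]

lemma mul_exp_one_sub_lt_one {lam : ℝ} (h1 : lam < 1) : lam * Real.exp (1 - lam) < 1 := by
  rw [mul_exp_one_sub, div_lt_one (Real.exp_pos _)]
  exact self_lt_exp_sub_one h1

lemma lambertW_mul_exp {y : ℝ} (hy : -1 ≤ y) : lambertW (y * Real.exp y) = y := by
  have hmono : StrictMonoOn (fun y : ℝ => y * Real.exp y) (Set.Ici (-1)) := by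
    refine strictMonoOn_of_deriv_pos (convex_Ici _) (by fun_prop) fun x hx => ?_
    rw [interior_Ici, Set.mem_Ioi] at hx
    have hd : HasDerivAt (fun y : ℝ => y * Real.exp y) (1 * Real.exp x + x * Real.exp x) x :=
      (hasDerivAt_id x).mul (Real.hasDerivAt_exp x)
    rw [hd.deriv, ← add_mul]
    exact mul_pos (by linarith) (Real.exp_pos x)
  exact hmono.injOn.leftInvOn_invFunOn hy

/-- The inverse of `f1 lam` on the upper branch. -/
def f1Inv (lam g : ℝ) : ℝ := 1 - lam + lam / g + Real.log g

/-- A finite-difference form of the derivative `(g - lam) / g ^ 2`, from `log x ≥ 1 - 1 / x` at `x =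
g' / g`. Monotonicity and Lipschitz bounds for `f1` follow from it without differentiating an
inverse function. -/
lemma le_f1Inv_sub {lam g g' : ℝ} (hg : 0 < g) (hgg : g ≤ g') :
    (g' - g) * (g - lam) / (g * g') ≤ f1Inv lam g' - f1Inv lam g := by
  have hg' : 0 < g' := hg.trans_le hgg
  have h := Real.one_sub_inv_le_log_of_pos (div_pos hg' hg)
  rw [Real.log_div hg'.ne' hg.ne', inv_div] at h
  have e : (g' - g) * (g - lam) / (g * g') = lam / g' - lam / g + (1 - g / g') := by
    field_simp
    ring
  rw [e, f1Inv, f1Inv]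
  linarith

lemma f1Inv_exp_sub_one (lam : ℝ) :
    f1Inv lam (Real.exp (lam - 1)) = lam * Real.exp (1 - lam) := by
  rw [f1Inv, Real.log_exp, mul_exp_one_sub]
  ring

lemma f1_f1Inv {lam g : ℝ} (h0 : 0 ≤ lam) (h1 : lam < 1) (hg : Real.exp (lam - 1) ≤ g)
    (hg1 : g ≤ 1) : f1 lam (f1Inv lam g) = g := by
  have hb := self_lt_exp_sub_one h1
  have hb0 := Real.exp_pos (lam - 1)
  have hg0 : 0 < g := hb0.trans_le hg
  have hge : ¬ f1Inv lam g < lam * Real.exp (1 - lam) := by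
    rw [not_lt, ← f1Inv_exp_sub_one]
    have := le_f1Inv_sub (lam := lam) hb0 hg
    have h2 : 0 ≤ (g - Real.exp (lam - 1)) * (Real.exp (lam - 1) - lam) /
        (Real.exp (lam - 1) * g) := by
      apply div_nonneg _ (by positivity)
      exact mul_nonneg (by linarith) (by linarith)
    linarith
  unfold f1
  split_ifs with hz hl
  · have h := le_f1Inv_sub (lam := lam) hg0 hg1
    have h2 : f1Inv lam 1 = 1 := by simp [f1Inv]
    rw [h2, hz, sub_self, div_le_iff₀ (by linarith), zero_mul] at h
    by_contra hne
    have : 0 < (1 - g) * (g - lam) :=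
      mul_pos (by rcases hg1.lt_or_eq with h | h; linarith; exact absurd h.symm hne) (by linarith)
    linarith
  · subst hl
    simp [f1Inv, Real.exp_log hg0]
  · have hlam : 0 < lam := lt_of_le_of_ne h0 (Ne.symm hl)
    -- The argument of `lambertW` is `y * exp y` with `y = -lam / g`; since `lam ≤ g`, this `y` lies
    -- on the principal branch.
    have e : -lam * Real.exp (1 - lam - f1Inv lam g) = (-lam / g) * Real.exp (-lam / g) := by
      have : 1 - lam - f1Inv lam g = -lam / g - Real.log g := by rw [f1Inv]; ring
      rw [this, Real.exp_sub, Real.exp_log hg0]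
      ring
    rw [e, lambertW_mul_exp]
    · field_simp
    · rw [le_div_iff₀ hg0]
      linarith

/-- The two branches of `f1`. -/
lemma f1_cases {lam z : ℝ} (h0 : 0 ≤ lam) (h1 : lam < 1) (hz1 : z ≤ 1) :
    (z < lam * Real.exp (1 - lam) ∧ z < 1 ∧ f1 lam z * (1 - z) = Real.exp (lam - 1) - lam ∧
      0 < f1 lam z ∧ f1 lam z < Real.exp (lam - 1)) ∨
    (lam * Real.exp (1 - lam) ≤ z ∧ Real.exp (lam - 1) ≤ f1 lam z ∧ f1 lam z ≤ 1 ∧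
      z = f1Inv lam (f1 lam z)) := by
  have hb := self_lt_exp_sub_one h1
  have hb0 := Real.exp_pos (lam - 1)
  have hs := mul_exp_one_sub_lt_one h1
  rcases lt_or_ge z (lam * Real.exp (1 - lam)) with hz | hz
  · have hz1' : z < 1 := hz.trans hs
    have e : f1 lam z = (Real.exp (lam - 1) - lam) / (1 - z) := by
      rw [f1, if_neg hz1'.ne, if_pos hz]
    refine Or.inl ⟨hz, hz1', ?_, ?_, ?_⟩
    · rw [e, div_mul_cancel₀ _ (by linarith)]
    · rw [e]
      exact div_pos (by linarith) (by linarith)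
    · rw [e, div_lt_iff₀ (by linarith)]
      rw [mul_exp_one_sub, lt_div_iff₀ hb0] at hz
      linarith
  · have hcont : ContinuousOn (f1Inv lam) (Set.Icc (Real.exp (lam - 1)) 1) := by
      intro x hx
      have hx0 : x ≠ 0 := (hb0.trans_le hx.1).ne'
      apply ContinuousAt.continuousWithinAt
      unfold f1Inv
      fun_prop (disch := assumption)
    have hb1 : Real.exp (lam - 1) ≤ 1 := Real.exp_le_one_iff.2 (by linarith)
    obtain ⟨g, hg, hgz⟩ := intermediate_value_Icc hb1 hcont
      (show z ∈ Set.Icc (f1Inv lam (Real.exp (lam - 1))) (f1Inv lam 1) by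
        rw [f1Inv_exp_sub_one]
        exact ⟨hz, by simpa [f1Inv] using hz1⟩)
    have e : f1 lam z = g := by rw [← hgz, f1_f1Inv h0 h1 hg.1 hg.2]
    exact Or.inr ⟨hz, by rw [e]; exact hg.1, by rw [e]; exact hg.2, by rw [e, hgz]⟩

lemma f1_one (lam : ℝ) : f1 lam 1 = 1 := by simp [f1]

lemma f1_le_one {lam z : ℝ} (h0 : 0 ≤ lam) (h1 : lam < 1) (hz1 : z ≤ 1) : f1 lam z ≤ 1 := by
  rcases f1_cases h0 h1 hz1 with ⟨-, -, -, -, h⟩ | ⟨-, -, h, -⟩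
  · exact h.le.trans (Real.exp_le_one_iff.2 (by linarith))
  · exact h

lemma le_f1 {lam z : ℝ} (h0 : 0 ≤ lam) (h1 : lam < 1) (hz0 : 0 ≤ z) (hz1 : z ≤ 1) :
    Real.exp (lam - 1) - lam ≤ f1 lam z := by
  rcases f1_cases h0 h1 hz1 with ⟨-, h, e, hp, -⟩ | ⟨-, h, -, -⟩
  · nlinarith
  · linarith

lemma f1_pos {lam z : ℝ} (h0 : 0 ≤ lam) (h1 : lam < 1) (hz1 : z ≤ 1) : 0 < f1 lam z := by
  rcases f1_cases h0 h1 hz1 with ⟨-, -, -, h, -⟩ | ⟨-, h, -, -⟩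
  · exact h
  · exact (Real.exp_pos _).trans_le h

lemma f1_zero {lam : ℝ} (h0 : 0 ≤ lam) (h1 : lam < 1) :
    f1 lam 0 = Real.exp (lam - 1) - lam := by
  rcases h0.eq_or_lt with rfl | h
  · simp [f1]
  · simp [f1, h, Real.exp_pos]

lemma f1_strictMonoOn {lam : ℝ} (h0 : 0 ≤ lam) (h1 : lam < 1) :
    StrictMonoOn (f1 lam) (Set.Iic 1) := by
  intro z hz z' hz' hlt
  have hb := self_lt_exp_sub_one h1
  have hb0 := Real.exp_pos (lam - 1)
  rcases f1_cases h0 h1 hz with ⟨ha, hz1, e, hp, hbd⟩ | ⟨ha, hbd, hle, e⟩ <;>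
    rcases f1_cases h0 h1 hz' with ⟨ha', hz1', e', hp', hbd'⟩ | ⟨ha', hbd', hle', e'⟩
  · by_contra! hcon
    nlinarith
  · linarith
  · linarith
  · by_contra! hcon
    have h := le_f1Inv_sub (lam := lam) (hb0.trans_le hbd') hcon
    rw [← e, ← e'] at h
    have : 0 ≤ (f1 lam z - f1 lam z') * (f1 lam z' - lam) / (f1 lam z' * f1 lam z) := by
      apply div_nonneg
      · exact mul_nonneg (by linarith) (by linarith)
      · exact (mul_pos (hb0.trans_le hbd') (hb0.trans_le hbd)).le
    linarith

lemma f1_mono {lam z z' : ℝ} (h0 : 0 ≤ lam) (h1 : lam < 1) (h : z ≤ z') (hz' : z' ≤ 1) :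
    f1 lam z ≤ f1 lam z' :=
  (f1_strictMonoOn h0 h1).monotoneOn (h.trans hz') hz' h

lemma f1_break {lam : ℝ} (h0 : 0 ≤ lam) (h1 : lam < 1) :
    f1 lam (lam * Real.exp (1 - lam)) = Real.exp (lam - 1) := by
  rw [← f1Inv_exp_sub_one]
  exact f1_f1Inv h0 h1 le_rfl (Real.exp_le_one_iff.2 (by linarith))

/-- An estimate for increments of `f1` holds if it holds on either branch. -/
lemma f1_branch_induction {lam : ℝ} (h0 : 0 ≤ lam) (h1 : lam < 1) {P : ℝ → ℝ → Prop}
    (hlow : ∀ z z', z ≤ z' → z' < 1 → f1 lam z * (1 - z) = Real.exp (lam - 1) - lam →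
      f1 lam z' * (1 - z') = Real.exp (lam - 1) - lam → f1 lam z' ≤ Real.exp (lam - 1) → P z z')
    (hhigh : ∀ z z', z ≤ z' → z' ≤ 1 → Real.exp (lam - 1) ≤ f1 lam z →
      z = f1Inv lam (f1 lam z) → z' = f1Inv lam (f1 lam z') → P z z')
    (htrans : ∀ z y z', z ≤ y → y ≤ z' → z' ≤ 1 → P z y → P y z' → P z z')
    {z z' : ℝ} (h : z ≤ z') (hz' : z' ≤ 1) : P z z' := by
  have hs := mul_exp_one_sub_lt_one h1
  have hbr := f1_break h0 h1
  rcases f1_cases h0 h1 (h.trans hz') with ⟨ha, hz1, e, hp, hbd⟩ | ⟨ha, hbd, hle, e⟩ <;>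
    rcases f1_cases h0 h1 hz' with ⟨ha', hz1', e', hp', hbd'⟩ | ⟨ha', hbd', hle', e'⟩
  · exact hlow _ _ h hz1' e e' hbd'.le
  · refine htrans _ (lam * Real.exp (1 - lam)) _ ha.le ha' hz' ?_ ?_
    · refine hlow _ _ ha.le hs e ?_ hbr.le
      rw [hbr, mul_exp_one_sub]
      field_simp
    · refine hhigh _ _ ha' hz' hbr.ge ?_ e'
      rw [hbr, f1Inv_exp_sub_one]
  · linarith
  · exact hhigh _ _ h hz' hbd e e'

/-- With `g = f1 z`, the derivative is `g ^ 2 / (b - lam)` on the lower branch and `g ^ 2 / (g -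
lam)` on the upper one, where `g ≥ b = exp (lam - 1)`. Both are at most `1 / (b - lam)`; this
Lipschitz bound gives continuity across the break point. -/
lemma f1_sub_le {lam z z' : ℝ} (h0 : 0 ≤ lam) (h1 : lam < 1) (h : z ≤ z') (hz' : z' ≤ 1) :
    (Real.exp (lam - 1) - lam) * (f1 lam z' - f1 lam z) ≤ z' - z := by
  have hb := self_lt_exp_sub_one h1
  have hb0 := Real.exp_pos (lam - 1)
  refine f1_branch_induction h0 h1
    (P := fun z z' => (Real.exp (lam - 1) - lam) * (f1 lam z' - f1 lam z) ≤ z' - z)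
    ?_ ?_ (fun z y z' _ _ _ h h' => by linarith) h hz'
  · intro z z' h hz1 e e' _
    have hp := f1_pos h0 h1 (h.trans hz1.le)
    have hp' := f1_pos h0 h1 hz1.le
    have hl := f1_le_one h0 h1 (h.trans hz1.le)
    have hl' := f1_le_one h0 h1 hz1.le
    have key : (Real.exp (lam - 1) - lam) * (f1 lam z' - f1 lam z) =
        f1 lam z * f1 lam z' * (z' - z) := by
      linear_combination f1 lam z * e' - f1 lam z' * e
    rw [key]
    have : f1 lam z * f1 lam z' ≤ 1 := by nlinarith
    nlinarith
  · intro z z' h hz1 hbd e e'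
    have hm := f1_mono h0 h1 h hz1
    have hl' := f1_le_one h0 h1 hz1
    have h2 := le_f1Inv_sub (lam := lam) (hb0.trans_le hbd) hm
    rw [← e, ← e', div_le_iff₀ (mul_pos (by linarith) (by linarith))] at h2
    have h3 : f1 lam z * f1 lam z' ≤ 1 := by nlinarith
    nlinarith

lemma f1_continuousOn {lam : ℝ} (h0 : 0 ≤ lam) (h1 : lam < 1) :
    ContinuousOn (f1 lam) (Set.Iic 1) := by
  have hb : 0 < Real.exp (lam - 1) - lam := sub_pos.2 (self_lt_exp_sub_one h1)
  refine (LipschitzOnWith.of_le_add_mul (Real.toNNReal (Real.exp (lam - 1) - lam)⁻¹)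
    fun z hz z' hz' => ?_).continuousOn
  rw [Real.coe_toNNReal _ (inv_nonneg.2 hb.le)]
  have hd := dist_nonneg (x := z) (y := z')
  rcases le_total z z' with h | h
  · have := f1_mono h0 h1 h hz'
    have : 0 ≤ (Real.exp (lam - 1) - lam)⁻¹ * dist z z' := by positivity
    linarith
  · have := f1_sub_le h0 h1 h hz
    rw [Real.dist_eq, abs_of_nonneg (sub_nonneg.2 h), inv_mul_eq_div]
    have h2 : f1 lam z - f1 lam z' ≤ (z - z') / (Real.exp (lam - 1) - lam) := by
      rw [le_div_iff₀ hb]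
      linarith
    linarith

/-- An antiderivative of `f1` in terms of the value `g` of `f1`. -/
def f1Potential (lam g : ℝ) : ℝ :=
  if g ≤ Real.exp (lam - 1) then
    (Real.exp (lam - 1) - lam) * (Real.log g - (lam - 1)) + Real.exp (lam - 1) - lam * (lam - 1)
  else g - lam * Real.log g

/-- The additive constant in the lower branch is chosen so that the two formulas agree at `exp (lam
- 1)`. -/
lemma f1Potential_of_ge {lam g : ℝ} (h : Real.exp (lam - 1) ≤ g) :
    f1Potential lam g = g - lam * Real.log g := by
  rcases h.eq_or_lt with rfl | h
  · simp [f1Potential]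
  · rw [f1Potential, if_neg h.not_ge]

/-- The integral of an increasing function is at most its right Riemann sum. -/
lemma f1Potential_sub_le {lam z z' : ℝ} (h0 : 0 ≤ lam) (h1 : lam < 1) (h : z ≤ z')
    (hz' : z' ≤ 1) :
    f1Potential lam (f1 lam z') - f1Potential lam (f1 lam z) ≤ f1 lam z' * (z' - z) := by
  have hb := self_lt_exp_sub_one h1
  have hb0 := Real.exp_pos (lam - 1)
  refine f1_branch_induction h0 h1 (P := fun z z' =>
    f1Potential lam (f1 lam z') - f1Potential lam (f1 lam z) ≤ f1 lam z' * (z' - z))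
    ?_ ?_ ?_ h hz'
  · intro z z' h hz1 e e' hbd
    have hp := f1_pos h0 h1 (h.trans hz1.le)
    have hp' := f1_pos h0 h1 hz1.le
    have hm := f1_mono h0 h1 h hz1.le
    rw [f1Potential, f1Potential, if_pos hbd, if_pos (hm.trans hbd)]
    have hlog := Real.log_le_sub_one_of_pos (div_pos hp' hp)
    rw [Real.log_div hp'.ne' hp.ne'] at hlog
    have key : f1 lam z' * (z' - z) =
        (Real.exp (lam - 1) - lam) * (f1 lam z' / f1 lam z - 1) := by
      field_simp
      linear_combination f1 lam z' * e - f1 lam z * e'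
    rw [key]
    nlinarith
  · intro z z' h hz1 hbd e e'
    have hm := f1_mono h0 h1 h hz1
    rw [f1Potential_of_ge hbd, f1Potential_of_ge (hbd.trans hm)]
    have hp := f1_pos h0 h1 (h.trans hz1)
    have hp' := f1_pos h0 h1 hz1
    generalize f1 lam z = g at *
    generalize f1 lam z' = g' at *
    rw [e, e', f1Inv, f1Inv]
    have hlog := Real.log_le_sub_one_of_pos (div_pos hp' hp)
    have hlog2 := Real.le_log_one_add_of_nonneg (x := g' / g - 1)
      (by rw [sub_nonneg, one_le_div hp]; exact hm)
    rw [show 1 + (g' / g - 1) = g' / g by ring] at hlog2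
    rw [Real.log_div hp'.ne' hp.ne'] at hlog hlog2
    set L := Real.log g' - Real.log g with hL
    have hup : g * L ≤ g' - g := by
      rw [div_sub_one hp.ne', le_div_iff₀ hp] at hlog
      linarith
    have hlow : 2 * (g' - g) ≤ (g' + g) * L := by
      have h2 : g' / g - 1 + 2 = (g' + g) / g := by field_simp; ring
      rw [h2, div_sub_one hp.ne', ← mul_div_assoc, div_div_div_cancel_right₀ hp.ne',
        div_le_iff₀ (by linarith)] at hlog2
      linarith
    -- The expression equals `(g - lam) * ((g' - g) - g * L) + g * ((g' + g) * L - 2 * (g' - g))`, a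
    -- combination of the two logarithm bounds with nonnegative coefficients.
    have key : 0 ≤ (g * L) * (g' + lam) - (g' - g) * (g + lam) := by
      nlinarith [mul_nonneg (sub_nonneg.2 (hb.le.trans hbd)) (sub_nonneg.2 hup),
        mul_nonneg hp.le (sub_nonneg.2 hlow)]
    have e3 : g' * (1 - lam + lam / g' + Real.log g' - (1 - lam + lam / g + Real.log g)) -
        (g' - lam * Real.log g' - (g - lam * Real.log g)) =
        ((g * L) * (g' + lam) - (g' - g) * (g + lam)) / g := by
      rw [hL]
      field_simp
      ring
    have := div_nonneg key hp.le
    linarith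
  · intro z y z' hzy hyz hz1 hy hy'
    have hm := f1_mono h0 h1 hyz hz1
    nlinarith

/-! ### The penalty -/

lemma exp_sub_one_le_f0 {lam z : ℝ} (h1 : lam ≤ 1) (hz : 0 ≤ z) :
    Real.exp (lam - 1) ≤ f0 lam z :=
  le_min (Real.exp_le_exp.2 (by linarith)) (Real.exp_le_one_iff.2 (by linarith))

lemma f0_mono (lam : ℝ) : Monotone (f0 lam) := fun _ _ h =>
  min_le_min_right _ (Real.exp_le_exp.2 (by linarith))

lemma f0_le_one (lam z : ℝ) : f0 lam z ≤ 1 := min_le_right _ _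

lemma f0_continuous (lam : ℝ) : Continuous (f0 lam) := by
  unfold f0
  fun_prop

lemma f0_pos (lam z : ℝ) : 0 < f0 lam z := lt_min (Real.exp_pos _) one_pos

lemma f1_one_left {z : ℝ} (hz : z < 1) : f1 1 z = 0 := by
  simp [f1, hz, hz.ne]

/-- The properties of a penalty, as a function of the fill level, that make the algorithm
well defined. -/
structure IsFillPenalty (p : ℝ → ℝ) : Prop where
  monotoneOn : MonotoneOn p (Set.Icc 0 1)
  nonneg : ∀ x ∈ Set.Icc (0 : ℝ) 1, 0 ≤ p x
  map_one : p 1 = 1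
  rightCont : ∀ x ∈ Set.Ico (0 : ℝ) 1, ContinuousWithinAt p (Set.Ioi x) x

/-- The only new discontinuity is at fill level `A`. The jump there is upward, and the point `A`
itself belongs to the upper piece, so right-continuity survives. -/
lemma isFillPenalty_of_f1 {lam A : ℝ} (hA : A ≤ 1) (hmono : MonotoneOn (f1 lam) (Set.Icc 0 1))
    (hnonneg : ∀ x ∈ Set.Icc (0 : ℝ) 1, 0 ≤ f1 lam x)
    (hcont : ∀ x ∈ Set.Ico (0 : ℝ) 1, ContinuousWithinAt (f1 lam) (Set.Ioi x) x) :
    IsFillPenalty (penalty lam A) where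
  monotoneOn := by
    intro x hx y hy hxy
    have h := hmono hx hy hxy
    unfold penalty
    split_ifs with h1 h2 h2
    · exact h
    · exact le_max_of_le_right h
    · linarith
    · exact max_le_max (f0_mono _ (by linarith)) h
  nonneg := by
    intro x hx
    unfold penalty
    split_ifs
    · exact hnonneg x hx
    · exact le_max_of_le_right (hnonneg x hx)
  map_one := by
    rw [penalty, if_neg hA.not_gt, f1_one]
    exact max_eq_right (f0_le_one _ _)
  rightCont := by
    intro x hx
    rcases lt_or_ge x A with h | h
    · refine (hcont x hx).congr_of_eventuallyEq ?_ (by simp [penalty, h])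
      filter_upwards [nhdsWithin_le_nhds (Iio_mem_nhds h)] with y hy
      rw [penalty, if_pos (Set.mem_Iio.1 hy)]
    · have hc : ContinuousWithinAt (fun y => max (f0 lam (y - A)) (f1 lam y)) (Set.Ioi x) x := by
        refine ContinuousWithinAt.sup ?_ (hcont x hx)
        exact ((f0_continuous lam).comp (by fun_prop)).continuousWithinAt
      refine hc.congr (fun y hy => ?_) (by rw [penalty, if_neg h.not_gt])
      rw [penalty, if_neg (h.trans (le_of_lt hy)).not_gt]

lemma penalty_isFillPenalty {lam A : ℝ} (hlam : lam ∈ Set.Icc (0 : ℝ) 1) (hA : A ≤ 1) :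
    IsFillPenalty (penalty lam A) := by
  rcases hlam.2.eq_or_lt with rfl | h1
  · have h01 : ∀ x ∈ Set.Icc (0 : ℝ) 1, f1 1 x = 0 ∨ (x = 1 ∧ f1 1 x = 1) := by
      intro x hx
      rcases hx.2.eq_or_lt with rfl | h
      · exact Or.inr ⟨rfl, f1_one 1⟩
      · exact Or.inl (f1_one_left h)
    refine isFillPenalty_of_f1 hA ?_ ?_ ?_
    · intro x hx y hy hxy
      rcases h01 x hx with h | ⟨h, h'⟩
      · rcases h01 y hy with h2 | ⟨-, h2⟩ <;> simp [h, h2]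
      · rw [le_antisymm hxy (h ▸ hy.2)]
    · intro x hx
      rcases h01 x hx with h | ⟨-, h⟩ <;> simp [h]
    · intro x hx
      refine (continuousWithinAt_const (b := (0 : ℝ))).congr_of_eventuallyEq ?_ (f1_one_left hx.2)
      filter_upwards [nhdsWithin_le_nhds (Iio_mem_nhds hx.2)] with y hy
      exact f1_one_left hy
  · refine isFillPenalty_of_f1 hA ?_ ?_ ?_
    · exact fun x _ y hy hxy => f1_mono hlam.1 h1 hxy hy.2
    · exact fun x hx => (f1_pos hlam.1 h1 hx.2).le
    · exact fun x hx => ((f1_continuousOn hlam.1 h1).continuousAt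
        (Iic_mem_nhds hx.2)).continuousWithinAt

/-- The penalty can be flat only where the cap on `f0` makes it 1. There the potential is 0, below
every positive level, so the plateau does no harm. -/
lemma penalty_lt {lam A x y : ℝ} (h0 : 0 ≤ lam) (h1 : lam < 1) (hxy : x < y) (hy : y ≤ 1) :
    penalty lam A y = 1 ∨ penalty lam A x < penalty lam A y := by
  have h := f1_strictMonoOn h0 h1 (hxy.le.trans hy) hy hxy
  unfold penalty
  split_ifs with hy' hx hx
  · exact Or.inr h
  · linarith
  · exact Or.inr (lt_max_of_lt_right h)
  · rcases (f0_le_one lam (y - A)).eq_or_lt with e | e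
    · left
      rw [e]
      exact max_eq_left (f1_le_one h0 h1 hy)
    · right
      refine max_lt (lt_max_of_lt_left ?_) (lt_max_of_lt_right h)
      have e' : Real.exp (y - A + lam - 1) < 1 := by
        by_contra! hc
        exact e.ne (min_eq_right hc)
      have e2 : Real.exp (x - A + lam - 1) < Real.exp (y - A + lam - 1) :=
        Real.exp_lt_exp.2 (by linarith)
      rw [f0, f0, min_eq_left e'.le, min_eq_left (e2.trans e').le]
      exact e2

/-! ### One arrival -/

lemma one_sub_mem_fillSet {lam w A X l : ℝ} (hp : penalty lam A 1 = 1) (hX : X ≤ 1)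
    (hl : 0 ≤ l) : 1 - X ∈ fillSet lam w A X l := by
  refine ⟨⟨by linarith, le_rfl⟩, ?_⟩
  rw [add_sub_cancel, hp]
  simpa using hl

lemma fillSet_bddBelow (lam w A X l : ℝ) : BddBelow (fillSet lam w A X l) :=
  ⟨0, fun _ hz => hz.1.1⟩

lemma mem_fillSet_of_le {lam w A X l z t : ℝ} (hp : IsFillPenalty (penalty lam A)) (hw : 0 ≤ w)
    (hX : 0 ≤ X) (hz : z ∈ fillSet lam w A X l) (hzt : z ≤ t) (ht : t ≤ 1 - X) :
    t ∈ fillSet lam w A X l := by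
  obtain ⟨⟨hz0, hz1⟩, hzl⟩ := hz
  refine ⟨⟨hz0.trans hzt, ht⟩, le_trans ?_ hzl⟩
  have := hp.monotoneOn (a := X + z) (b := X + t) ⟨by linarith, by linarith⟩
    ⟨by linarith, by linarith⟩ (by linarith)
  gcongr

/-- By monotonicity the set is an interval ending at `1 - X`; right-continuity of the penalty puts
its left endpoint in it. -/
lemma isLeast_fillSet {lam w A X l : ℝ} (hp : IsFillPenalty (penalty lam A)) (hw : 0 ≤ w)
    (hX : X ∈ Set.Icc (0 : ℝ) 1) (hl : 0 ≤ l) :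
    IsLeast (fillSet lam w A X l) (sInf (fillSet lam w A X l)) := by
  have hne := one_sub_mem_fillSet (w := w) hp.map_one hX.2 hl
  have hbdd := fillSet_bddBelow lam w A X l
  refine ⟨?_, fun z hz => csInf_le hbdd hz⟩
  set s := sInf (fillSet lam w A X l) with hs
  have hs0 : 0 ≤ s := le_csInf ⟨_, hne⟩ fun z hz => hz.1.1
  rcases (show s ≤ 1 - X from csInf_le hbdd hne).eq_or_lt with h | h
  · rw [h]
    exact hne
  · refine ⟨⟨hs0, h.le⟩, ?_⟩
    have hc : Filter.Tendsto (fun t => w * (1 - penalty lam A t))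
        (nhdsWithin (X + s) (Set.Ioi (X + s))) (nhds (w * (1 - penalty lam A (X + s)))) :=
      (tendsto_const_nhds.sub (hp.rightCont (X + s) ⟨by linarith [hX.1], by linarith⟩)).const_mul w
    refine le_of_tendsto hc ?_
    filter_upwards [self_mem_nhdsWithin,
      nhdsWithin_le_nhds (Iio_mem_nhds (show X + s < 1 by linarith))] with t ht ht1
    obtain ⟨z, hz, hzt⟩ := exists_lt_of_csInf_lt ⟨_, hne⟩
      (show sInf (fillSet lam w A X l) < t - X by rw [← hs]; linarith [Set.mem_Ioi.1 ht])
    have := (mem_fillSet_of_le hp hw hX.1 hz hzt.le (by linarith [Set.mem_Iio.1 ht1])).2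
    rwa [add_sub_cancel] at this

/-- Weights, advice loads and fill levels that can occur in a run. -/
structure IsState {U : Type u} (lam : ℝ) (w : U → ℝ) (A X : U → ℝ) : Prop where
  weight_nonneg : ∀ u, 0 ≤ w u
  penalty : ∀ u, IsFillPenalty (penalty lam (A u))
  fill_mem : ∀ u, X u ∈ Set.Icc (0 : ℝ) 1

section Arrival

variable {U : Type u} {lam : ℝ} {w : U → ℝ} {N : Set U} {A X : U → ℝ} {l : ℝ} {u : U}

lemma allocAt_of_mem (hu : u ∈ N) :
    allocAt lam w N A X l u = sInf (fillSet lam (w u) (A u) (X u) l) := if_pos hu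

lemma allocAt_of_notMem (hu : u ∉ N) : allocAt lam w N A X l u = 0 := if_neg hu

lemma IsState.isLeast (h : IsState lam w A X) (hl : 0 ≤ l) (hu : u ∈ N) :
    IsLeast (fillSet lam (w u) (A u) (X u) l) (allocAt lam w N A X l u) := by
  rw [allocAt_of_mem hu]
  exact isLeast_fillSet (h.penalty u) (h.weight_nonneg u) (h.fill_mem u) hl

lemma IsState.allocAt_nonneg (h : IsState lam w A X) (hl : 0 ≤ l) (u : U) :
    0 ≤ allocAt lam w N A X l u := by
  by_cases hu : u ∈ N
  · exact (h.isLeast hl hu).1.1.1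
  · rw [allocAt_of_notMem hu]

lemma IsState.allocAt_le (h : IsState lam w A X) (hl : 0 ≤ l) (u : U) :
    allocAt lam w N A X l u ≤ 1 - X u := by
  by_cases hu : u ∈ N
  · exact (h.isLeast hl hu).1.1.2
  · rw [allocAt_of_notMem hu]
    linarith [(h.fill_mem u).2]

lemma IsState.lt_of_lt_allocAt (h : IsState lam w A X) (hl : 0 ≤ l) (hu : u ∈ N) {z : ℝ}
    (hz : X u ≤ z) (hz' : z < X u + allocAt lam w N A X l u) :
    l < w u * (1 - OBM.penalty lam (A u) z) := by
  by_contra! hc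
  have := (h.isLeast hl hu).2 (show z - X u ∈ _ from ⟨⟨by linarith, by
    linarith [h.allocAt_le (N := N) hl u]⟩, by rwa [add_sub_cancel]⟩)
  linarith

/-- The allocation is right-continuous in the level. -/
lemma IsState.eventually_lt_allocAt (h : IsState lam w A X) (hl : 0 ≤ l) (u : U) {c : ℝ}
    (hc : c < allocAt lam w N A X l u) :
    ∀ᶠ l' in nhdsWithin l (Set.Ioi l), c < allocAt lam w N A X l' u := by
  by_cases hu : u ∈ N
  · rcases lt_or_ge c 0 with hc0 | hc0
    · filter_upwards [self_mem_nhdsWithin] with l' hl'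
      exact hc0.trans_le (h.allocAt_nonneg (hl.trans (le_of_lt hl')) u)
    · have h1 := h.lt_of_lt_allocAt (N := N) hl hu (z := X u + c) (by linarith) (by linarith)
      filter_upwards [self_mem_nhdsWithin, nhdsWithin_le_nhds (Iio_mem_nhds h1)] with l' hl' hl''
      by_contra! hcon
      have hl0 : 0 ≤ l' := hl.trans (le_of_lt hl')
      have := mem_fillSet_of_le (h.penalty u) (h.weight_nonneg u) (h.fill_mem u).1
        (h.isLeast hl0 hu).1 hcon (hc.le.trans (h.allocAt_le hl u))
      exact absurd this.2 (not_le.2 hl'')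
  · rw [allocAt_of_notMem hu] at hc
    filter_upwards with l'
    rwa [allocAt_of_notMem hu]

/-- The allocation is left-continuous in the level where the penalty is strictly increasing. -/
lemma IsState.eventually_allocAt_lt (h : IsState lam w A X) (h0 : 0 ≤ lam) (h1 : lam < 1)
    (hl : 0 < l) (u : U) {c : ℝ} (hc : allocAt lam w N A X l u < c) :
    ∀ᶠ l' in nhdsWithin l (Set.Iio l), allocAt lam w N A X l' u < c := by
  by_cases hu : u ∈ N
  · obtain ⟨d, hd, hdc⟩ := exists_between hc
    have hpos : ∀ᶠ l' in nhdsWithin l (Set.Iio l), 0 ≤ l' := by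
      filter_upwards [nhdsWithin_le_nhds (Ioi_mem_nhds hl)] with l' hl'
      exact le_of_lt hl'
    rcases lt_or_ge d (1 - X u) with hd1 | hd1
    · have hm := (h.isLeast hl.le hu).1
      have hlt : w u * (1 - OBM.penalty lam (A u) (X u + d)) < l := by
        rcases penalty_lt (A := A u) h0 h1 (show X u + allocAt lam w N A X l u < X u + d by
          linarith) (by linarith) with e | e
        · rw [e]
          simpa using hl
        · rcases (h.weight_nonneg u).eq_or_lt with ew | ew
          · rw [← ew]
            simpa using hl
          · refine lt_of_lt_of_le ?_ hm.2
            exact mul_lt_mul_of_pos_left (by linarith) ew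
      filter_upwards [hpos, nhdsWithin_le_nhds (Ioi_mem_nhds hlt)] with l' hl0 hl'
      refine lt_of_le_of_lt ((h.isLeast hl0 hu).2 ⟨⟨?_, hd1.le⟩, le_of_lt hl'⟩) hdc
      linarith [hm.1.1]
    · filter_upwards [hpos] with l' hl0
      linarith [h.allocAt_le (N := N) hl0 u]
  · rw [allocAt_of_notMem hu] at hc
    filter_upwards with l'
    rwa [allocAt_of_notMem hu]

variable [Fintype U]

lemma levelSet_bddBelow : BddBelow (levelSet lam w N A X) := ⟨0, fun _ hl => hl.1⟩

lemma IsState.levelSet_nonempty (h : IsState lam w A X) : (levelSet lam w N A X).Nonempty := by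
  have hnn : 0 ≤ ∑ u, w u := Finset.sum_nonneg fun u _ => h.weight_nonneg u
  -- At this level every potential is already low enough, so nothing is allocated.
  refine ⟨∑ u, w u, hnn, ?_⟩
  refine (Finset.sum_nonpos fun u _ => ?_).trans zero_le_one
  by_cases hu : u ∈ N
  · refine (h.isLeast hnn hu).2 ⟨⟨le_rfl, by linarith [(h.fill_mem u).2]⟩, ?_⟩
    have h2 := Finset.single_le_sum (fun u _ => h.weight_nonneg u) (Finset.mem_univ u)
    have h3 := (h.penalty u).nonneg _ (h.fill_mem u)
    rw [add_zero]
    nlinarith [h.weight_nonneg u]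
  · rw [allocAt_of_notMem hu]

lemma IsState.isLeast_levelSet (h : IsState lam w A X) :
    IsLeast (levelSet lam w N A X) (sInf (levelSet lam w N A X)) := by
  refine ⟨?_, fun l hl => csInf_le levelSet_bddBelow hl⟩
  set s := sInf (levelSet lam w N A X) with hs
  have hs0 : 0 ≤ s := le_csInf h.levelSet_nonempty fun l hl => hl.1
  refine ⟨hs0, ?_⟩
  by_contra! hcon
  -- With `card U + 1` in the denominator, losing `ε` at every vertex still leaves the sum above 1,
  -- and an empty `U` needs no separate treatment.
  have hε : 0 < (∑ u, allocAt lam w N A X s u - 1) / (Fintype.card U + 1) :=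
    div_pos (by linarith) (by positivity)
  set ε := (∑ u, allocAt lam w N A X s u - 1) / (Fintype.card U + 1) with he
  have hev : ∀ᶠ l' in nhdsWithin s (Set.Ioi s),
      ∀ u, allocAt lam w N A X s u - ε < allocAt lam w N A X l' u :=
    Filter.eventually_all.2 fun u => h.eventually_lt_allocAt hs0 u (by linarith)
  have hgt : ∀ᶠ l' in nhdsWithin s (Set.Ioi s), 1 < ∑ u, allocAt lam w N A X l' u := by
    filter_upwards [hev] with l' hl'
    have h1 : ∑ u, (allocAt lam w N A X s u - ε) ≤ ∑ u, allocAt lam w N A X l' u :=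
      Finset.sum_le_sum fun u _ => (hl' u).le
    have h2 : ε * (Fintype.card U + 1) = ∑ u, allocAt lam w N A X s u - 1 :=
      div_mul_cancel₀ _ (by positivity)
    rw [Finset.sum_sub_distrib, Finset.sum_const, Finset.card_univ, nsmul_eq_mul] at h1
    nlinarith
  obtain ⟨b, hb, hb'⟩ := (mem_nhdsGT_iff_exists_Ioo_subset).1 hgt
  obtain ⟨l, hl, hlb⟩ := exists_lt_of_csInf_lt h.levelSet_nonempty (hs ▸ Set.mem_Ioi.1 hb)
  rcases (csInf_le levelSet_bddBelow hl).eq_or_lt with e | e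
  · rw [← hs] at e
    rw [e] at hcon
    exact absurd hl.2 (not_le.2 hcon)
  · exact absurd hl.2 (not_le.2 (hb' ⟨e, hlb⟩))

/-- A positive level is only used when the arriving vertex is completely matched. -/
lemma IsState.sum_labStep (h : IsState lam w A X) (h0 : 0 ≤ lam) (h1 : lam < 1)
    (hl : 0 < sInf (levelSet lam w N A X)) : ∑ u, labStep lam w N A X u = 1 := by
  refine le_antisymm h.isLeast_levelSet.1.2 ?_
  unfold labStep
  set s := sInf (levelSet lam w N A X) with hs
  by_contra! hcon
  have hε : 0 < (1 - ∑ u, allocAt lam w N A X s u) / (Fintype.card U + 1) :=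
    div_pos (by linarith) (by positivity)
  set ε := (1 - ∑ u, allocAt lam w N A X s u) / (Fintype.card U + 1) with he
  have hev : ∀ᶠ l' in nhdsWithin s (Set.Iio s),
      ∀ u, allocAt lam w N A X l' u < allocAt lam w N A X s u + ε :=
    Filter.eventually_all.2 fun u => h.eventually_allocAt_lt h0 h1 hl u (by linarith)
  have hpos : ∀ᶠ l' in nhdsWithin s (Set.Iio s), 0 < l' :=
    nhdsWithin_le_nhds (Ioi_mem_nhds hl)
  obtain ⟨l', hl', hl0, hlt⟩ := (hev.and (hpos.and self_mem_nhdsWithin)).exists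
  refine absurd (h.isLeast_levelSet.2 (show l' ∈ levelSet lam w N A X from ⟨hl0.le, ?_⟩))
    (not_le.2 hlt)
  have h3 : ∑ u, allocAt lam w N A X l' u ≤ ∑ u, (allocAt lam w N A X s u + ε) :=
    Finset.sum_le_sum fun u _ => (hl' u).le
  have h2 : ε * (Fintype.card U + 1) = 1 - ∑ u, allocAt lam w N A X s u :=
    div_mul_cancel₀ _ (by positivity)
  rw [Finset.sum_add_distrib, Finset.sum_const, Finset.card_univ, nsmul_eq_mul] at h3
  nlinarith

end Arrival

/-! ### Runs of the algorithm -/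

/-! ### Partial sums over the arrivals -/

section Load

variable {U : Type u} {n : ℕ} {a : U → Fin n → ℝ}

@[simp] lemma adviceLoad_zero (a : U → Fin n → ℝ) (u : U) : adviceLoad a 0 u = 0 := by
  simp [adviceLoad]

lemma adviceLoad_succ (a : U → Fin n → ℝ) (k : ℕ) (u : U) :
    adviceLoad a (k + 1) u = adviceLoad a k u + if h : k < n then a u ⟨k, h⟩ else 0 := by
  unfold adviceLoad
  split_ifs with h
  · have : (Finset.univ.filter fun v : Fin n => (v : ℕ) < k + 1) =
        insert ⟨k, h⟩ (Finset.univ.filter fun v : Fin n => (v : ℕ) < k) := by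
      ext v
      simp [Fin.ext_iff]
      omega
    rw [this, Finset.sum_insert (by simp), add_comm]
  · rw [add_zero]
    congr 1
    ext v
    have := v.2
    simp
    omega

lemma adviceLoad_fin_succ (a : U → Fin n → ℝ) (v : Fin n) (u : U) :
    adviceLoad a (v + 1) u = adviceLoad a v u + a u v := by
  rw [adviceLoad_succ, dif_pos v.2]

lemma adviceLoad_self (a : U → Fin n → ℝ) (u : U) : adviceLoad a n u = ∑ v, a u v := by
  simp [adviceLoad]

lemma adviceLoad_le {k m : ℕ} (hkm : k ≤ m) {u : U} (h : ∀ v, 0 ≤ a u v) :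
    adviceLoad a k u ≤ adviceLoad a m u := by
  refine Finset.sum_le_sum_of_subset_of_nonneg (fun v hv => ?_) fun v _ _ => h v
  simp only [Finset.mem_filter] at hv ⊢
  exact ⟨hv.1, hv.2.trans_le hkm⟩

lemma adviceLoad_le_sum {k : ℕ} {u : U} (h : ∀ v, 0 ≤ a u v) :
    adviceLoad a k u ≤ ∑ v, a u v :=
  Finset.sum_le_sum_of_subset_of_nonneg (Finset.filter_subset _ _) fun v _ _ => h v

/-- Telescoping bound for a partial sum over the first arrivals. -/
lemma le_adviceLoad_of_step {P : ℕ → ℝ} {u : U} {m : ℕ} (hm : m ≤ n)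
    (h : ∀ v : Fin n, (v : ℕ) < m → P (v + 1) - P v ≤ a u v) {k : ℕ} (hk : k ≤ m) :
    P k - P 0 ≤ adviceLoad a k u := by
  induction k with
  | zero => simp
  | succ k ih =>
    have h1 := h ⟨k, by omega⟩ (by simpa using hk)
    have h2 := ih (by omega)
    rw [adviceLoad_succ, dif_pos (by omega)]
    simp only at h1
    linarith

end Load

/-! ### Invariants, feasibility and the online property of a run -/

section Run

variable {U : Type u} [Fintype U] {n : ℕ} {lam : ℝ} {I : Instance U n} {a : U → Fin n → ℝ}

lemma labLoad_succ (lam : ℝ) (I : Instance U n) (a : U → Fin n → ℝ) (k : ℕ) (u : U) :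
    labLoad lam I a (k + 1) u = labLoad lam I a k u +
      if h : k < n then LAB lam U n I a u ⟨k, h⟩ else 0 := rfl

lemma labLoad_fin_succ (lam : ℝ) (I : Instance U n) (a : U → Fin n → ℝ) (v : Fin n) (u : U) :
    labLoad lam I a (v + 1) u = labLoad lam I a v u + LAB lam U n I a u v := by
  rw [labLoad_succ, dif_pos v.2]

lemma labLoad_eq_adviceLoad (lam : ℝ) (I : Instance U n) (a : U → Fin n → ℝ) (k : ℕ) (u : U) :
    labLoad lam I a k u = adviceLoad (LAB lam U n I a) k u := by
  induction k with
  | zero => simp [labLoad]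
  | succ k ih =>
    rw [labLoad_succ, adviceLoad_succ, ih]

lemma IsFractionalMatching.adviceLoad_le_one (ha : IsFractionalMatching I a) (k : ℕ) (u : U) :
    adviceLoad a k u ≤ 1 :=
  (adviceLoad_le_sum (ha.nonneg u)).trans (ha.offline_le u)

lemma IsFractionalMatching.isState (ha : IsFractionalMatching I a) (hlam : lam ∈ Set.Icc (0 : ℝ) 1)
    (k : ℕ) : IsState lam I.w (adviceLoad a (k + 1)) (labLoad lam I a k) := by
  refine ⟨I.w_nonneg, fun u => penalty_isFillPenalty hlam (ha.adviceLoad_le_one _ _), ?_⟩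
  induction k with
  | zero => exact fun u => by simp [labLoad]
  | succ k ih =>
    intro u
    rw [labLoad_succ]
    split_ifs with h
    · have hs : IsState lam I.w (adviceLoad a (k + 1)) (labLoad lam I a k) :=
        ⟨I.w_nonneg, fun u => penalty_isFillPenalty hlam (ha.adviceLoad_le_one _ _), ih⟩
      have hl := (hs.isLeast_levelSet (N := {u' | I.E u' ⟨k, h⟩})).1.1
      constructor
      · exact add_nonneg (ih u).1 (hs.allocAt_nonneg hl u)
      · have := hs.allocAt_le (N := {u' | I.E u' ⟨k, h⟩}) hl u
        exact le_sub_iff_add_le'.1 this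
    · simpa using ih u

lemma LAB_wellDefined (hlam : lam ∈ Set.Icc (0 : ℝ) 1) : LABWellDefined.{u} lam := by
  intro U _ n I a ha v
  have hs := ha.isState hlam v
  exact ⟨fun u _ l hl => isLeast_fillSet (hs.penalty u) (hs.weight_nonneg u) (hs.fill_mem u) hl,
    hs.isLeast_levelSet⟩

/-- The potential level used at the arrival of `v`. -/
def labLevel (lam : ℝ) (I : Instance U n) (a : U → Fin n → ℝ) (v : Fin n) : ℝ :=
  sInf (levelSet lam I.w {u | I.E u v} (adviceLoad a (v + 1)) (labLoad lam I a v))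

lemma labLevel_nonneg (ha : IsFractionalMatching I a) (hlam : lam ∈ Set.Icc (0 : ℝ) 1)
    (v : Fin n) : 0 ≤ labLevel lam I a v :=
  (ha.isState hlam v).isLeast_levelSet.1.1

lemma LAB_isFractionalMatching (ha : IsFractionalMatching I a)
    (hlam : lam ∈ Set.Icc (0 : ℝ) 1) : IsFractionalMatching I (LAB lam U n I a) where
  nonneg u v := (ha.isState hlam v).allocAt_nonneg (labLevel_nonneg ha hlam v) u
  off_edges u v h := allocAt_of_notMem h
  offline_le u := by
    rw [← adviceLoad_self, ← labLoad_eq_adviceLoad]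
    exact ((ha.isState hlam n).fill_mem u).2
  online_le v := (ha.isState hlam v).isLeast_levelSet.1.2

lemma LAB_isOnline (hlam : lam ∈ Set.Icc (0 : ℝ) 1) :
    IsOnlineMatchingAlgorithm.{u} (LAB lam) := by
  refine ⟨fun U _ n I a ha => LAB_isFractionalMatching ha hlam, ?_⟩
  intro U _ n m I J a b _ _ hw i hn hm hrev u
  have hA : ∀ k ≤ i + 1, adviceLoad a k = adviceLoad b k := by
    intro k
    induction k with
    | zero => exact fun _ => by ext u; simp
    | succ k ih =>
      intro hk
      ext u
      rw [adviceLoad_succ, adviceLoad_succ, ih (by omega), dif_pos (by omega), dif_pos (by omega),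
        (hrev k (by omega) u).2]
  have hN : ∀ k (hk : k ≤ i), {u | I.E u ⟨k, hk.trans_lt hn⟩} = {u | J.E u ⟨k, hk.trans_lt hm⟩} :=
    fun k hk => Set.ext fun u => (hrev k hk u).1
  have hX : ∀ k ≤ i, labLoad lam I a k = labLoad lam J b k := by
    intro k
    induction k with
    | zero => exact fun _ => rfl
    | succ k ih =>
      intro hk
      ext u
      rw [labLoad_succ, labLoad_succ, ih (by omega), dif_pos (by omega), dif_pos (by omega)]
      show _ + labStep lam I.w {u' | I.E u' ⟨k, _⟩} (adviceLoad a (k + 1)) (labLoad lam I a k) u =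
        _ + labStep lam J.w {u' | J.E u' ⟨k, _⟩} (adviceLoad b (k + 1)) (labLoad lam J b k) u
      rw [hw, hN k (by omega), hA (k + 1) (by omega), ih (by omega)]
  show labStep lam I.w {u' | I.E u' ⟨i, hn⟩} (adviceLoad a (i + 1)) (labLoad lam I a i) u =
    labStep lam J.w {u' | J.E u' ⟨i, hm⟩} (adviceLoad b (i + 1)) (labLoad lam J b i) u
  rw [hw, hN i le_rfl, hA _ le_rfl, hX i le_rfl]

lemma value_nonneg {x : U → Fin n → ℝ} (hx : IsFractionalMatching I x) : 0 ≤ value I x :=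
  Finset.sum_nonneg fun u _ => Finset.sum_nonneg fun v _ =>
    mul_nonneg (I.w_nonneg u) (hx.nonneg u v)

lemma mul_opt_le {r s : ℝ} (hr : 0 ≤ r) (hs : 0 ≤ s)
    (h : ∀ x, IsFractionalMatching I x → r * value I x ≤ s) : r * opt I ≤ s := by
  rcases hr.eq_or_lt with rfl | hr
  · simpa using hs
  · rw [mul_comm, ← le_div_iff₀ hr]
    refine Real.sSup_le ?_ (div_nonneg hs hr.le)
    rintro _ ⟨x, hx, rfl⟩
    rw [le_div_iff₀ hr, mul_comm]
    exact h x hx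

/-- The effect of one arrival on one offline vertex of weight `w`, whose advice load and fill level
change from `A, X` to `A', X'`, when the level is `l`. -/
structure IsArrivalStep (lam w l A X A' X' : ℝ) : Prop where
  weight_nonneg : 0 ≤ w
  load_le : A ≤ A'
  load_le_one : A' ≤ 1
  fill_nonneg : 0 ≤ X
  fill_le : X ≤ X'
  fill_le_one : X' ≤ 1
  le_level : (A' = A ∧ X' = X) ∨ w * (1 - penalty lam A' X') ≤ l
  level_lt : ∀ z, X ≤ z → z < X' → l < w * (1 - penalty lam A' z)

lemma le_labLevel (ha : IsFractionalMatching I a) (hlam : lam ∈ Set.Icc (0 : ℝ) 1) {u : U}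
    {v : Fin n} (h : I.E u v) :
    I.w u * (1 - penalty lam (adviceLoad a (v + 1) u) (labLoad lam I a (v + 1) u)) ≤
      labLevel lam I a v := by
  rw [labLoad_fin_succ]
  exact ((ha.isState hlam v).isLeast (N := {u | I.E u v}) (labLevel_nonneg ha hlam v) h).1.2

lemma isArrivalStep (ha : IsFractionalMatching I a) (hlam : lam ∈ Set.Icc (0 : ℝ) 1)
    (u : U) (v : Fin n) :
    IsArrivalStep lam (I.w u) (labLevel lam I a v) (adviceLoad a v u) (labLoad lam I a v u)
      (adviceLoad a (v + 1) u) (labLoad lam I a (v + 1) u) where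
  weight_nonneg := I.w_nonneg u
  load_le := adviceLoad_le (Nat.le_succ _) (ha.nonneg u)
  load_le_one := ha.adviceLoad_le_one _ _
  fill_nonneg := ((ha.isState hlam v).fill_mem u).1
  fill_le := by
    rw [labLoad_fin_succ]
    linarith [(LAB_isFractionalMatching ha hlam).nonneg u v]
  fill_le_one := ((ha.isState hlam (v + 1)).fill_mem u).2
  le_level := by
    by_cases h : I.E u v
    · exact Or.inr (le_labLevel ha hlam h)
    · refine Or.inl ⟨?_, ?_⟩
      · rw [adviceLoad_fin_succ, ha.off_edges u v h, add_zero]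
      · rw [labLoad_fin_succ, (LAB_isFractionalMatching ha hlam).off_edges u v h, add_zero]
  level_lt := by
    intro z hz hz'
    rw [labLoad_fin_succ] at hz'
    by_cases h : I.E u v
    · exact (ha.isState hlam v).lt_of_lt_allocAt (N := {u | I.E u v})
        (labLevel_nonneg ha hlam v) h hz hz'
    · rw [(LAB_isFractionalMatching ha hlam).off_edges u v h, add_zero] at hz'
      linarith

/-- Complementary slackness: either the level vanishes or `v` is fully matched. It allows the level
to serve as the dual value of `v`. -/
lemma labLevel_mul_sum (ha : IsFractionalMatching I a) (h0 : 0 ≤ lam) (h1 : lam < 1)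
    (v : Fin n) : labLevel lam I a v * ∑ u, LAB lam U n I a u v = labLevel lam I a v := by
  rcases (labLevel_nonneg ha ⟨h0, h1.le⟩ v).eq_or_lt with h | h
  · rw [← h, zero_mul]
  · have := (ha.isState ⟨h0, h1.le⟩ v).sum_labStep (N := {u | I.E u v}) h0 h1 h
    simp only [LAB, this, mul_one]

end Run

/-! ### The case `lam = 1`: following the advice -/

section FollowAdvice

variable {U : Type u} [Fintype U] {n : ℕ} {I : Instance U n} {a : U → Fin n → ℝ}

lemma penalty_one {A X : ℝ} (hA : A ≤ 1) (hX : X ≤ 1) : penalty 1 A X = if X < A then 0 else 1 := by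
  unfold penalty
  split_ifs with h
  · exact f1_one_left (h.trans_le hA)
  · have e : f0 1 (X - A) = 1 := by
      refine min_eq_right (Real.one_le_exp ?_)
      linarith
    rw [e, max_eq_left]
    rcases hX.eq_or_lt with rfl | h
    · rw [f1_one]
    · rw [f1_one_left h]
      exact zero_le_one

/-- The threshold penalty brings a potential to 0 exactly when the advice load is reached, and the
advice for `v` sums to at most 1, so level 0 is admissible. A vertex of weight 0 has potential 0
from the start and receives nothing, hence the case distinction. -/
lemma LAB_one_apply (ha : IsFractionalMatching I a) (v : Fin n)
    (hX : ∀ u, labLoad 1 I a v u = if I.w u = 0 then 0 else adviceLoad a v u) (u : U) :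
    LAB 1 U n I a u v = if I.w u = 0 then 0 else a u v := by
  have hs := ha.isState (lam := 1) (by simp) v
  have hz : ∀ u, allocAt 1 I.w {u | I.E u v} (adviceLoad a (v + 1)) (labLoad 1 I a v) 0 u =
      if I.w u = 0 then 0 else a u v := by
    intro u
    by_cases hu : I.E u v
    · have hm := hs.isLeast (N := {u | I.E u v}) le_rfl hu
      have hle := ha.adviceLoad_le_one (v + 1) u
      have hnn := ha.nonneg u v
      refine hm.unique ?_
      have hXu := hX u
      split_ifs at hXu ⊢ with hw
      · refine ⟨⟨⟨le_rfl, ?_⟩, ?_⟩, fun z hz => hz.1.1⟩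
        · rw [hXu]
          simp
        · simp [hw]
      · have hpen : ∀ z, z ≤ 1 - adviceLoad a v u →
            penalty 1 (adviceLoad a (v + 1) u) (adviceLoad a v u + z) =
              if z < a u v then 0 else 1 := by
          intro z hz
          rw [penalty_one hle (by linarith), adviceLoad_fin_succ]
          simp
        rw [adviceLoad_fin_succ] at hle
        have hw0 : 0 < I.w u := lt_of_le_of_ne (I.w_nonneg u) (Ne.symm hw)
        rw [hXu]
        refine ⟨⟨⟨hnn, by linarith⟩, ?_⟩, ?_⟩
        · rw [hpen _ (by linarith)]
          simp
        · rintro z ⟨⟨hz0, hz1⟩, hz2⟩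
          rw [hpen _ hz1] at hz2
          by_contra! hcon
          rw [if_pos hcon] at hz2
          linarith
    · rw [allocAt_of_notMem (N := {u | I.E u v}) hu, ha.off_edges u v hu, ite_self]
  have hl : labLevel 1 I a v = 0 := by
    refine le_antisymm (hs.isLeast_levelSet.2 ⟨le_rfl, ?_⟩) (labLevel_nonneg ha (by simp) v)
    refine le_trans (Finset.sum_le_sum fun u _ => ?_) (ha.online_le v)
    rw [hz]
    split_ifs
    · exact ha.nonneg u v
    · exact le_rfl
  have e : LAB 1 U n I a u v = allocAt 1 I.w {u | I.E u v} (adviceLoad a (v + 1))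
      (labLoad 1 I a v) (labLevel 1 I a v) u := rfl
  rw [e, hl, hz]

lemma labLoad_one (ha : IsFractionalMatching I a) {k : ℕ} (hk : k ≤ n) (u : U) :
    labLoad 1 I a k u = if I.w u = 0 then 0 else adviceLoad a k u := by
  induction k generalizing u with
  | zero => simp [labLoad]
  | succ k ih =>
    have h := labLoad_fin_succ 1 I a ⟨k, hk⟩ u
    rw [LAB_one_apply ha ⟨k, hk⟩ (fun u => ih (by omega) u),
      ih (by omega)] at h
    rw [adviceLoad_succ, dif_pos (by omega)]
    simp only at h
    rw [h]
    split_ifs <;> simp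

lemma value_LAB_one (ha : IsFractionalMatching I a) : value I (LAB 1 U n I a) = value I a := by
  refine Finset.sum_congr rfl fun u _ => Finset.sum_congr rfl fun v _ => ?_
  rw [LAB_one_apply ha v fun u => labLoad_one ha v.2.le u]
  split_ifs with h
  · simp [h]
  · rfl

end FollowAdvice

/-! ### Potential functions -/

/-- The maximum of `y * (lam + D - log y)` over `y ∈ [g, 1]`, see `le_slopePotential`: a convex
function of `D` whose slope at `D` is `max g (f0 lam D)`. -/
def slopePotential (lam g D : ℝ) : ℝ :=
  max g (f0 lam D) * (lam + D - Real.log (max g (f0 lam D)))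

/-- The function of `y` is concave with derivative `lam + D - 1 - log y`, which vanishes at `exp (D
+ lam - 1)`. Clamping this point to `[g, 1]` gives the maximiser `max g (f0 lam D)`. -/
lemma le_slopePotential {lam g y : ℝ} (D : ℝ) (hg : 0 < g) (hgy : g ≤ y) (hy : y ≤ 1) :
    y * (lam + D - Real.log y) ≤ slopePotential lam g D := by
  unfold slopePotential
  set m := max g (f0 lam D) with hm
  have hy0 : 0 < y := hg.trans_le hgy
  have hm0 : 0 < m := hg.trans_le (le_max_left _ _)
  have hlog := Real.log_le_sub_one_of_pos (div_pos hm0 hy0)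
  rw [Real.log_div hm0.ne' hy0.ne', div_sub_one hy0.ne', le_div_iff₀ hy0] at hlog
  -- By concavity only the first-order optimality condition at `m` is left.
  suffices h : (lam + D - 1 - Real.log m) * (y - m) ≤ 0 by linarith
  have hexp : Real.exp (D + lam - 1) ≤ 1 ∨ 0 ≤ D + lam - 1 := by
    rw [Real.exp_le_one_iff]
    exact le_total _ _
  rcases le_total (f0 lam D) g with h | h
  · have e : m = g := max_eq_left h
    rw [e]
    rcases hexp with h1 | h1
    · rw [f0, min_eq_left h1, ← Real.le_log_iff_exp_le hg] at h
      exact mul_nonpos_of_nonpos_of_nonneg (by linarith) (by linarith)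
    · rw [f0, min_eq_right (Real.one_le_exp h1)] at h
      rw [le_antisymm (hy.trans h) hgy]
      simp
  · have e : m = f0 lam D := max_eq_right h
    rw [e]
    rcases hexp with h1 | h1
    · rw [f0, min_eq_left h1, Real.log_exp]
      refine le_of_eq ?_
      ring
    · rw [f0, min_eq_right (Real.one_le_exp h1), Real.log_one]
      exact mul_nonpos_of_nonneg_of_nonpos (by linarith) (by linarith)

/-- A maximum of affine functions of `D` has the slope of the piece active at `D'` as a subgradient
there: the maximiser for `D'` also competes at `D`. -/
lemma slopePotential_sub_le {lam g : ℝ} (D D' : ℝ) (hg : 0 < g) (hg1 : g ≤ 1) :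
    slopePotential lam g D' - slopePotential lam g D ≤ max g (f0 lam D') * (D' - D) := by
  have h := le_slopePotential (lam := lam) D hg (le_max_left g (f0 lam D'))
    (max_le hg1 (f0_le_one lam D'))
  have e : slopePotential lam g D' =
      max g (f0 lam D') * (lam + D' - Real.log (max g (f0 lam D'))) := rfl
  linarith

lemma slopePotential_anti {lam g g' : ℝ} (D : ℝ) (hg : 0 < g) (hgg : g ≤ g') (hg1 : g' ≤ 1) :
    slopePotential lam g' D ≤ slopePotential lam g D :=
  le_slopePotential D hg (hgg.trans (le_max_left _ _)) (max_le hg1 (f0_le_one lam D))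

lemma f0_of_nonpos {lam D : ℝ} (hD : D ≤ 0) : f0 lam D ≤ Real.exp (lam - 1) :=
  (min_le_left _ _).trans (Real.exp_le_exp.2 (by linarith))

lemma f0_zero {lam : ℝ} (h1 : lam ≤ 1) : f0 lam 0 = Real.exp (lam - 1) :=
  le_antisymm (f0_of_nonpos le_rfl) (exp_sub_one_le_f0 h1 le_rfl)

lemma slopePotential_exp_zero {lam : ℝ} (h1 : lam ≤ 1) :
    slopePotential lam (Real.exp (lam - 1)) 0 = Real.exp (lam - 1) := by
  rw [slopePotential, f0_zero h1, max_self, Real.log_exp]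
  ring

/-- The largest loss against the advice that can still occur, relative to the weight, for an offline
vertex with `f1`-value `g` and excess `D` of the fill level over the advice load. -/
def lossPotential (lam g D : ℝ) : ℝ :=
  slopePotential lam (max g (Real.exp (lam - 1))) D +
    (max g (Real.exp (lam - 1)) - g) * max (-D) 0 - lam

section LossPotential

variable {lam g g' D D' : ℝ}

/-- For `D' ≤ 0` the correction term lowers the slope from `max g (exp (lam - 1))` to `g`, the
penalty below the advice load. At `D' = 0` this bound and the next both hold: the convex kink
mirrors the jump of the penalty. -/
lemma lossPotential_sub_le_of_nonpos (h1 : lam ≤ 1) (hg1 : g ≤ 1) (hD : D' ≤ 0) :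
    lossPotential lam g D' - lossPotential lam g D ≤ g * (D' - D) := by
  have hb1 : Real.exp (lam - 1) ≤ 1 := Real.exp_le_one_iff.2 (by linarith)
  have h := slopePotential_sub_le (lam := lam) (g := max g (Real.exp (lam - 1))) D D'
    (lt_max_of_lt_right (Real.exp_pos _)) (max_le hg1 hb1)
  rw [max_eq_left ((f0_of_nonpos hD).trans (le_max_right _ _))] at h
  rw [lossPotential, lossPotential, max_eq_left (show 0 ≤ -D' by linarith)]
  have h2 := mul_le_mul_of_nonneg_left (le_max_left (-D) 0)
    (sub_nonneg.2 (le_max_left g (Real.exp (lam - 1))))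
  linarith

lemma lossPotential_sub_le_of_nonneg (h1 : lam ≤ 1) (hg1 : g ≤ 1) (hD : 0 ≤ D') :
    lossPotential lam g D' - lossPotential lam g D ≤ max (f0 lam D') g * (D' - D) := by
  have hb1 : Real.exp (lam - 1) ≤ 1 := Real.exp_le_one_iff.2 (by linarith)
  have h := slopePotential_sub_le (lam := lam) (g := max g (Real.exp (lam - 1))) D D'
    (lt_max_of_lt_right (Real.exp_pos _)) (max_le hg1 hb1)
  rw [max_assoc, max_eq_right (exp_sub_one_le_f0 h1 hD),
    max_comm g (f0 lam D')] at h
  rw [lossPotential, lossPotential, max_eq_right (show -D' ≤ 0 by linarith)]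
  have h2 := mul_nonneg (sub_nonneg.2 (le_max_left g (Real.exp (lam - 1)))) (le_max_right (-D) 0)
  linarith

lemma lossPotential_anti (h1 : lam ≤ 1) (hg1 : g' ≤ 1) (h : g ≤ g') :
    lossPotential lam g' D ≤ lossPotential lam g D := by
  have hb1 : Real.exp (lam - 1) ≤ 1 := Real.exp_le_one_iff.2 (by linarith)
  have hK := slopePotential_anti (lam := lam) (g := max g (Real.exp (lam - 1)))
    (g' := max g' (Real.exp (lam - 1))) D (lt_max_of_lt_right (Real.exp_pos _))
    (max_le_max_right _ h) (max_le hg1 hb1)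
  have hle : max g' (Real.exp (lam - 1)) - g' ≤ max g (Real.exp (lam - 1)) - g := by
    rcases le_total g' (Real.exp (lam - 1)) with h2 | h2
    · rw [max_eq_right h2, max_eq_right (h.trans h2)]
      linarith
    · rw [max_eq_left h2]
      linarith [le_max_left g (Real.exp (lam - 1))]
  have := mul_le_mul_of_nonneg_right hle (le_max_right (-D) 0)
  unfold lossPotential
  linarith

lemma lossPotential_zero (h0 : 0 ≤ lam) (h1 : lam ≤ 1) :
    lossPotential lam (Real.exp (lam - 1) - lam) 0 = Real.exp (lam - 1) - lam := by
  rw [lossPotential, max_eq_right (by linarith), slopePotential_exp_zero h1]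
  simp

/-- With `g = f1 X` and `y = max g (exp (lam - 1))`, either branch of `f1` says `y * (lam - log y) -
lam = g * (1 - X)`. Testing the maximum at `y` and using `max (-D) 0 ≥ -D` gives the bound `g * (1 -
X) + g * (X - A) = g * (1 - A)`, and `g ≥ exp (lam - 1) - lam`. -/
lemma le_lossPotential {A X : ℝ} (h0 : 0 ≤ lam) (h1 : lam < 1) (hX0 : 0 ≤ X) (hX1 : X ≤ 1)
    (hA : A ≤ 1) :
    (Real.exp (lam - 1) - lam) * (1 - A) ≤ lossPotential lam (f1 lam X) (X - A) := by
  have hb0 := Real.exp_pos (lam - 1)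
  have hb1 : Real.exp (lam - 1) ≤ 1 := Real.exp_le_one_iff.2 (by linarith)
  have hg1 := f1_le_one h0 h1 hX1
  have hgl := le_f1 h0 h1 hX0 hX1
  have hid : max (f1 lam X) (Real.exp (lam - 1)) *
      (lam - Real.log (max (f1 lam X) (Real.exp (lam - 1)))) - lam = f1 lam X * (1 - X) := by
    rcases f1_cases h0 h1 hX1 with ⟨-, -, e, -, h⟩ | ⟨-, h, -, e⟩
    · rw [max_eq_right h.le, Real.log_exp, e]
      ring
    · rw [max_eq_left h]
      have hp := hb0.trans_le h
      generalize f1 lam X = g at *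
      rw [e, f1Inv]
      field_simp
      ring
  have hK := le_slopePotential (lam := lam) (g := max (f1 lam X) (Real.exp (lam - 1))) (X - A)
    (lt_max_of_lt_right hb0) le_rfl (max_le hg1 hb1)
  have h2 := mul_le_mul_of_nonneg_left (le_max_left (-(X - A)) 0)
    (sub_nonneg.2 (le_max_left (f1 lam X) (Real.exp (lam - 1))))
  have h3 := mul_le_mul_of_nonneg_right hgl (sub_nonneg.2 hA)
  unfold lossPotential
  linarith

end LossPotential

/-! ### Estimates for one arrival -/

namespace IsArrivalStep

variable {lam w l A X A' X' : ℝ}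

/-- Just before `X'` the potential still exceeds `l`. The limit from the left is taken through a
continuous minorant `q`, because the penalty itself may jump at `X' = A'`. -/
lemma of_eventually (s : IsArrivalStep lam w l A X A' X') (hX : X < X') {q : ℝ → ℝ}
    (hq : ContinuousWithinAt q (Set.Iio X') X')
    (h : ∀ᶠ z in nhdsWithin X' (Set.Iio X'), q z ≤ penalty lam A' z) : w * q X' ≤ w - l := by
  refine le_of_tendsto (Filter.Tendsto.const_mul w hq) ?_
  filter_upwards [h, self_mem_nhdsWithin, nhdsWithin_le_nhds (Ioi_mem_nhds hX)] with z hz hz1 hz2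
  have h1 := s.level_lt z (le_of_lt hz2) hz1
  have h2 := mul_le_mul_of_nonneg_left hz s.weight_nonneg
  linarith

lemma f1_le (s : IsArrivalStep lam w l A X A' X') (h0 : 0 ≤ lam) (h1 : lam < 1) (hX : X < X') :
    w * f1 lam X' ≤ w - l := by
  refine s.of_eventually hX (((f1_continuousOn h0 h1) X' s.fill_le_one).mono
    fun z hz => (le_of_lt hz).trans s.fill_le_one) (Filter.Eventually.of_forall fun z => ?_)
  unfold penalty
  split_ifs
  · exact le_rfl
  · exact le_max_right _ _

lemma f0_le (s : IsArrivalStep lam w l A X A' X') (hX : X < X') (hA : A' < X') :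
    w * f0 lam (X' - A') ≤ w - l := by
  refine s.of_eventually (q := fun z => f0 lam (z - A')) hX
    ((f0_continuous lam).comp (by fun_prop)).continuousWithinAt ?_
  filter_upwards [nhdsWithin_le_nhds (Ioi_mem_nhds hA)] with z hz
  rw [penalty, if_neg (le_of_lt hz).not_gt]
  exact le_max_left _ _

lemma level_le (s : IsArrivalStep lam w l A X A' X') (h0 : 0 ≤ lam) (h1 : lam < 1)
    (hX : X < X') : 0 ≤ w - l :=
  (mul_nonneg s.weight_nonneg (f1_pos h0 h1 s.fill_le_one).le).trans (s.f1_le h0 h1 hX)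

/-- Monotonicity in `g` allows the final `g` to be used throughout; the subgradient at the final
excess then bounds the increment. If the excess grows, the fill level grew, so `w` times the slope
is at most `w - l`. Otherwise the level rule gives the reverse inequality, which is the one needed
for a nonpositive change. -/
lemma lossPotential_sub_le (s : IsArrivalStep lam w l A X A' X') (h0 : 0 ≤ lam) (h1 : lam < 1) :
    w * (lossPotential lam (f1 lam X') (X' - A') - lossPotential lam (f1 lam X) (X - A)) ≤
      (w - l) * ((X' - A') - (X - A)) := by
  have hg := f1_mono h0 h1 s.fill_le s.fill_le_one
  have hg1 := f1_le_one h0 h1 s.fill_le_one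
  have hanti := lossPotential_anti (D := X - A) h1.le hg1 hg
  suffices h : w * (lossPotential lam (f1 lam X') (X' - A') -
      lossPotential lam (f1 lam X') (X - A)) ≤ (w - l) * ((X' - A') - (X - A)) by
    nlinarith [s.weight_nonneg]
  rcases lt_or_ge (X - A) (X' - A') with hup | hdown
  · have hX : X < X' := by linarith [s.load_le]
    have hf1 := s.f1_le h0 h1 hX
    rcases le_or_gt (X' - A') 0 with hD | hD
    · have h2 := lossPotential_sub_le_of_nonpos (D := X - A) h1.le hg1 hD
      nlinarith [mul_le_mul_of_nonneg_left h2 s.weight_nonneg]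
    · have h2 := lossPotential_sub_le_of_nonneg (D := X - A) h1.le hg1 hD.le
      have hf0 := s.f0_le hX (by linarith)
      have hm : w * max (f0 lam (X' - A')) (f1 lam X') ≤ w - l := by
        rw [mul_max_of_nonneg _ _ s.weight_nonneg]
        exact max_le hf0 hf1
      nlinarith [mul_le_mul_of_nonneg_left h2 s.weight_nonneg]
  · rcases s.le_level with ⟨hA, hX⟩ | hl
    · rw [hA, hX]
      simp
    · unfold penalty at hl
      split_ifs at hl with hD
      · have h2 := lossPotential_sub_le_of_nonpos (D := X - A) h1.le hg1
          (show X' - A' ≤ 0 by linarith)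
        nlinarith [mul_le_mul_of_nonneg_left h2 s.weight_nonneg]
      · have h2 := lossPotential_sub_le_of_nonneg (D := X - A) h1.le hg1
          (show 0 ≤ X' - A' by linarith)
        nlinarith [mul_le_mul_of_nonneg_left h2 s.weight_nonneg]

lemma f1Potential_sub_le (s : IsArrivalStep lam w l A X A' X') (h0 : 0 ≤ lam) (h1 : lam < 1) :
    w * f1Potential lam (f1 lam X') - w * f1Potential lam (f1 lam X) ≤ (w - l) * (X' - X) := by
  rcases s.fill_le.eq_or_lt with h | h
  · simp [h]
  · have h2 := OBM.f1Potential_sub_le h0 h1 s.fill_le s.fill_le_one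
    nlinarith [mul_le_mul_of_nonneg_left h2 s.weight_nonneg, s.f1_le h0 h1 h]

/-- `B` stands for the advice load at a later arrival. Loads only grow, so measuring the excess
against `B` can only lower `f0`, and one fixed reference load telescopes. -/
lemma slopePotential_sub_le (s : IsArrivalStep lam w l A X A' X') (h0 : 0 ≤ lam) (h1 : lam < 1)
    {B : ℝ} (hB : A' ≤ B) :
    w * slopePotential lam (Real.exp (lam - 1)) (max (X' - B) 0) -
      w * slopePotential lam (Real.exp (lam - 1)) (max (X - B) 0) ≤ (w - l) * (X' - X) := by
  rcases s.fill_le.eq_or_lt with h | h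
  · simp [h]
  · rcases le_or_gt X' B with hX | hX
    · rw [max_eq_right (by linarith), max_eq_right (by linarith), sub_self]
      exact mul_nonneg (s.level_le h0 h1 h) (by linarith)
    · rw [max_eq_left (show 0 ≤ X' - B by linarith)]
      have h2 := OBM.slopePotential_sub_le (lam := lam) (max (X - B) 0) (X' - B)
        (Real.exp_pos (lam - 1)) (Real.exp_le_one_iff.2 (by linarith))
      rw [max_eq_right (exp_sub_one_le_f0 h1.le (by linarith))] at h2
      have h3 := s.f0_le h (hB.trans_lt hX)
      have h4 : f0 lam (X' - B) ≤ f0 lam (X' - A') := f0_mono _ (by linarith)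
      have h5 : X' - B - max (X - B) 0 ≤ X' - X := by linarith [le_max_left (X - B) 0]
      have h6 := mul_le_mul_of_nonneg_left h5 (f0_pos lam (X' - B)).le
      have h7 := mul_le_mul_of_nonneg_left (h2.trans h6) s.weight_nonneg
      have h8 := mul_le_mul_of_nonneg_left h4 s.weight_nonneg
      have h9 := mul_le_mul_of_nonneg_right (h8.trans h3) (sub_nonneg.2 h.le)
      linarith

end IsArrivalStep

/-! ### The guarantees -/

lemma robustness_eq {lam : ℝ} (h0 : 0 ≤ lam) (h1 : lam < 1) :
    robustness lam = 1 - f1Potential lam (Real.exp (lam - 1) - lam) := by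
  have hb := self_lt_exp_sub_one h1
  have hb0 := Real.exp_pos (lam - 1)
  rw [f1Potential, if_pos (by linarith), robustness, mul_exp_one_sub, one_sub_div hb0.ne',
    Real.log_div (by linarith) hb0.ne', Real.log_exp]
  ring

lemma self_le_f1Potential {lam X : ℝ} (h0 : 0 ≤ lam) (h1 : lam < 1) (hX0 : 0 ≤ X) (hX1 : X ≤ 1) :
    f1 lam X ≤ f1Potential lam (f1 lam X) := by
  have hb := self_lt_exp_sub_one h1
  have hb0 := Real.exp_pos (lam - 1)
  have hgl := le_f1 h0 h1 hX0 hX1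
  have hg1 := f1_le_one h0 h1 hX1
  have hg0 := f1_pos h0 h1 hX1
  generalize f1 lam X = g at *
  rcases le_total g (Real.exp (lam - 1)) with h | h
  · rw [f1Potential, if_pos h]
    have hlog := Real.one_sub_inv_le_log_of_pos (div_pos hg0 hb0)
    rw [Real.log_div hg0.ne' hb0.ne', Real.log_exp, inv_div] at hlog
    have h2 := mul_le_mul_of_nonneg_left hlog (sub_nonneg.2 hb.le)
    have h3 : 0 ≤ (Real.exp (lam - 1) - g) * (g - (Real.exp (lam - 1) - lam)) / g :=
      div_nonneg (mul_nonneg (by linarith) (by linarith)) hg0.le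
    have h4 : (Real.exp (lam - 1) - lam) * (1 - Real.exp (lam - 1) / g) +
        (Real.exp (lam - 1) - g) =
        (Real.exp (lam - 1) - g) * (g - (Real.exp (lam - 1) - lam)) / g := by
      field_simp
      ring
    nlinarith
  · rw [f1Potential_of_ge h]
    nlinarith [Real.log_nonpos hg0.le hg1]

/-- The inequality `x ≤ sinh x` at `x = -log √t` reads `-(t * log t) ≤ (1 - t) * √t`. -/
lemma neg_mul_log_le {t q : ℝ} (ht : 0 < t) (ht1 : t ≤ 1) (hq : 0 ≤ q) (htq : t ≤ q ^ 2) :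
    -(t * Real.log t) ≤ (1 - t) * q := by
  have hR : 0 < √t := Real.sqrt_pos.2 ht
  have hR1 : √t ≤ 1 := Real.sqrt_le_one.2 ht1
  have hRq : √t ≤ q := Real.sqrt_le_iff.2 ⟨hq, htq⟩
  have hRt : √t * √t = t := Real.mul_self_sqrt ht.le
  have hlog : Real.log t = 2 * Real.log √t := by
    rw [Real.log_sqrt ht.le]
    ring
  have hs := Real.self_le_sinh_iff.2 (neg_nonneg.2 (Real.log_nonpos hR.le hR1))
  rw [Real.sinh_eq, neg_neg, Real.exp_neg, Real.exp_log hR] at hs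
  have h2 := mul_le_mul_of_nonneg_left hs ht.le
  have h3 : t * (((√t)⁻¹ - √t) / 2) * 2 = (1 - t) * √t := by
    field_simp
    nlinarith
  have h4 := mul_le_mul_of_nonneg_left hRq (sub_nonneg.2 ht1)
  rw [hlog]
  linarith

/-- With `t = 1 - lam * exp (1 - lam)` and the common factor `exp (lam - 1)` removed, the claim is
`-(t * log t) ≤ (1 - t) * (1 - lam)`. Here `t ≤ (1 - lam) ^ 2` because `exp (1 - lam) ≥ 2 - lam`. -/
lemma robustness_le {lam : ℝ} (h0 : 0 ≤ lam) (h1 : lam < 1) :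
    robustness lam ≤ 1 - Real.exp (lam - 1) := by
  have hb := self_lt_exp_sub_one h1
  have hb0 := Real.exp_pos (lam - 1)
  have h2 : (2 - lam) * lam ≤ lam * Real.exp (1 - lam) := by
    nlinarith [Real.add_one_le_exp (1 - lam)]
  have ht := mul_exp_one_sub_lt_one h1
  have hs0 : 0 ≤ lam * Real.exp (1 - lam) := by positivity
  have h3 := neg_mul_log_le (t := 1 - lam * Real.exp (1 - lam)) (q := 1 - lam) (by linarith)
    (by linarith) (by linarith) (by nlinarith)
  have h4 := mul_le_mul_of_nonneg_left h3 hb0.le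
  have e : Real.exp (lam - 1) * (lam * Real.exp (1 - lam)) = lam := by
    rw [mul_exp_one_sub]
    field_simp
  unfold robustness
  have e2 : Real.exp (lam - 1) - lam =
    Real.exp (lam - 1) * (1 - lam * Real.exp (1 - lam)) := by rw [mul_sub, e, mul_one]
  have e3 : Real.exp (lam - 1) * ((1 - (1 - lam * Real.exp (1 - lam))) * (1 - lam)) =
    lam * (1 - lam) := by rw [sub_sub_cancel, ← mul_assoc, e]
  rw [e2]
  linarith

lemma robustness_one : robustness 1 = 0 := by simp [robustness]

lemma robustness_mem {lam : ℝ} (hlam : lam ∈ Set.Icc (0 : ℝ) 1) :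
    robustness lam ∈ Set.Icc (0 : ℝ) 1 := by
  rcases hlam.2.eq_or_lt with rfl | h1
  · simp [robustness_one]
  · refine ⟨?_, (robustness_le hlam.1 h1).trans (by linarith [Real.exp_pos (lam - 1)])⟩
    have hs := mul_exp_one_sub_lt_one h1
    have h2 := Real.log_nonpos (x := 1 - lam * Real.exp (1 - lam)) (by linarith)
      (by linarith [mul_nonneg hlam.1 (Real.exp_pos (1 - lam)).le])
    have h3 := mul_nonneg (sub_nonneg.2 (self_le_exp_sub_one lam)) (neg_nonneg.2 h2)
    have h4 : Real.exp (lam - 1) * (2 - lam) ≤ 1 := by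
      have := mul_le_mul_of_nonneg_left (Real.add_one_le_exp (1 - lam)) (Real.exp_pos (lam - 1)).le
      rw [← Real.exp_add, show lam - 1 + (1 - lam) = 0 by ring, Real.exp_zero] at this
      linarith
    have h5 : Real.exp (lam - 1) ≤ 1 - lam * (1 - lam) := by
      -- The product equals `1 + (1 - lam) ^ 3`.
      have h6 : 1 ≤ (1 - lam * (1 - lam)) * (2 - lam) := by
        nlinarith [mul_nonneg hlam.1 (sq_nonneg (1 - lam)), hlam.1, hlam.2, sq_nonneg (1 - lam)]
      nlinarith
    unfold robustness
    linarith

lemma consistency_mem {lam : ℝ} (hlam : lam ∈ Set.Icc (0 : ℝ) 1) :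
    consistency lam ∈ Set.Icc (0 : ℝ) 1 := by
  have h : Real.exp (lam - 1) ≤ 1 := Real.exp_le_one_iff.2 (by linarith [hlam.2])
  have h2 := self_le_exp_sub_one lam
  unfold consistency
  exact ⟨by linarith [hlam.1], by linarith⟩

/-! ### Per-vertex and per-edge inequalities, and their summation over the graph -/

section Guarantees

variable {U : Type u} [Fintype U] {n : ℕ} {lam : ℝ} {I : Instance U n} {a : U → Fin n → ℝ}

/-- Telescoping `lossPotential` bounds the loss `∑ v, (w - l v) * (a u v - x u v)` by `(exp (lam -
1) - lam) * w * A`. The level terms are kept because they cancel favourably only after summation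
over the offline side. -/
lemma consistency_mul_sum_le (ha : IsFractionalMatching I a) (h0 : 0 ≤ lam) (h1 : lam < 1)
    (u : U) :
    consistency lam * ∑ v, I.w u * a u v ≤
      ∑ v, (I.w u * LAB lam U n I a u v +
        labLevel lam I a v * (a u v - LAB lam U n I a u v)) := by
  have hlam : lam ∈ Set.Icc (0 : ℝ) 1 := ⟨h0, h1.le⟩
  have h := le_adviceLoad_of_step (n := n) (m := n) (u := u)
    (a := fun u v => (I.w u - labLevel lam I a v) * (LAB lam U n I a u v - a u v))
    (P := fun k => I.w u * lossPotential lam (f1 lam (labLoad lam I a k u))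
      (labLoad lam I a k u - adviceLoad a k u)) le_rfl (fun v _ => by
        have hs := (isArrivalStep ha hlam u v).lossPotential_sub_le h0 h1
        have e : labLoad lam I a (v + 1) u - adviceLoad a (v + 1) u -
            (labLoad lam I a v u - adviceLoad a v u) = LAB lam U n I a u v - a u v := by
          rw [labLoad_fin_succ, adviceLoad_fin_succ]
          ring
        rw [e] at hs
        linarith) le_rfl
  rw [adviceLoad_self (fun u v => (I.w u - labLevel lam I a v) *
    (LAB lam U n I a u v - a u v))] at h
  have hz : labLoad lam I a 0 u = 0 := rfl
  have hend := le_lossPotential (A := adviceLoad a n u) h0 h1 ((ha.isState hlam n).fill_mem u).1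
    ((ha.isState hlam n).fill_mem u).2 (ha.adviceLoad_le_one n u)
  simp only [hz, adviceLoad_zero, sub_zero, f1_zero h0 h1, lossPotential_zero h0 h1.le] at h
  have hend' := mul_le_mul_of_nonneg_left hend (I.w_nonneg u)
  have hsum : ∑ v, (I.w u * LAB lam U n I a u v +
      labLevel lam I a v * (a u v - LAB lam U n I a u v)) =
      I.w u * adviceLoad a n u +
        ∑ v, (I.w u - labLevel lam I a v) * (LAB lam U n I a u v - a u v) := by
    rw [adviceLoad_self, Finset.mul_sum, ← Finset.sum_add_distrib]
    exact Finset.sum_congr rfl fun v _ => by ring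
  rw [hsum, ← Finset.mul_sum, ← adviceLoad_self, consistency]
  linarith

lemma consistency_mul_value_le (ha : IsFractionalMatching I a) (h0 : 0 ≤ lam) (h1 : lam < 1) :
    consistency lam * value I a ≤ value I (LAB lam U n I a) := by
  have hlam : lam ∈ Set.Icc (0 : ℝ) 1 := ⟨h0, h1.le⟩
  have h : consistency lam * value I a ≤ ∑ u, ∑ v, (I.w u * LAB lam U n I a u v +
      labLevel lam I a v * (a u v - LAB lam U n I a u v)) := by
    rw [value, Finset.mul_sum]
    exact Finset.sum_le_sum fun u _ => consistency_mul_sum_le ha h0 h1 u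
  refine h.trans ?_
  simp only [Finset.sum_add_distrib]
  have h2 : ∑ u, ∑ v, labLevel lam I a v * (a u v - LAB lam U n I a u v) ≤ 0 := by
    rw [Finset.sum_comm]
    refine Finset.sum_nonpos fun v _ => ?_
    rw [← Finset.mul_sum, Finset.sum_sub_distrib, mul_sub, labLevel_mul_sum ha h0 h1]
    have := mul_le_mul_of_nonneg_left (ha.online_le v) (labLevel_nonneg ha hlam v)
    linarith
  unfold value
  linarith

lemma dual_nonneg (ha : IsFractionalMatching I a) (h0 : 0 ≤ lam) (h1 : lam < 1) (u : U)
    (v : Fin n) : 0 ≤ (I.w u - labLevel lam I a v) * LAB lam U n I a u v := by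
  have hs := isArrivalStep ha ⟨h0, h1.le⟩ u v
  have e := labLoad_fin_succ lam I a v u
  rcases ((LAB_isFractionalMatching ha ⟨h0, h1.le⟩).nonneg u v).eq_or_lt with h | h
  · rw [← h, mul_zero]
  · exact mul_nonneg (hs.level_le h0 h1 (by linarith)) h.le

/-- Approximate dual feasibility. -/
lemma robustness_mul_weight_le (ha : IsFractionalMatching I a) (h0 : 0 ≤ lam) (h1 : lam < 1)
    {u : U} {v : Fin n} (huv : I.E u v) :
    robustness lam * I.w u ≤
      ∑ v', (I.w u - labLevel lam I a v') * LAB lam U n I a u v' + labLevel lam I a v := by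
  have hlam : lam ∈ Set.Icc (0 : ℝ) 1 := ⟨h0, h1.le⟩
  have hz : labLoad lam I a 0 u = 0 := rfl
  have hw := I.w_nonneg u
  -- The level of `v` controls the penalty at this moment only; the later dual contributions are
  -- nonnegative and are dropped.
  have hle := adviceLoad_le_sum (k := v + 1)
    (a := fun u v => (I.w u - labLevel lam I a v) * LAB lam U n I a u v)
    (fun v => dual_nonneg ha h0 h1 u v)
  have e : ∀ v : Fin n, labLoad lam I a (v + 1) u - labLoad lam I a v u = LAB lam U n I a u v :=
    fun v => by rw [labLoad_fin_succ, add_sub_cancel_left]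
  have hJ := le_adviceLoad_of_step (n := n) (m := v + 1) (u := u)
    (a := fun u v => (I.w u - labLevel lam I a v) * LAB lam U n I a u v)
    (P := fun k => I.w u * f1Potential lam (f1 lam (labLoad lam I a k u))) v.2 (fun v' _ => by
      have hs := (isArrivalStep ha hlam u v').f1Potential_sub_le h0 h1
      rwa [e] at hs) le_rfl
  have hK := le_adviceLoad_of_step (n := n) (m := v + 1) (u := u)
    (a := fun u v => (I.w u - labLevel lam I a v) * LAB lam U n I a u v)
    (P := fun k => I.w u * slopePotential lam (Real.exp (lam - 1))
      (max (labLoad lam I a k u - adviceLoad a (v + 1) u) 0)) v.2 (fun v' hv' => by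
      have hs := (isArrivalStep ha hlam u v').slopePotential_sub_le h0 h1
        (adviceLoad_le (m := v + 1) hv' (ha.nonneg u))
      rwa [e] at hs) le_rfl
  have hA0 : 0 ≤ adviceLoad a (v + 1) u := Finset.sum_nonneg fun v _ => ha.nonneg u v
  have hlev := le_labLevel ha hlam huv
  have hX := (ha.isState hlam (v + 1)).fill_mem u
  simp only [hz, f1_zero h0 h1] at hJ hK
  rw [max_eq_right (show 0 - adviceLoad a (v + 1) u ≤ 0 by linarith),
    slopePotential_exp_zero h1.le] at hK
  generalize labLoad lam I a (v + 1) u = X at *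
  generalize adviceLoad a (v + 1) u = A at *
  have hJ2 := mul_le_mul_of_nonneg_left (self_le_f1Potential h0 h1 hX.1 hX.2) hw
  have h_of_f1 : I.w u * (1 - f1 lam X) ≤ labLevel lam I a v → robustness lam * I.w u ≤
      ∑ v', (I.w u - labLevel lam I a v') * LAB lam U n I a u v' + labLevel lam I a v := by
    intro h
    rw [robustness_eq h0 h1]
    linarith
  unfold penalty at hlev
  split_ifs at hlev with hXA
  · exact h_of_f1 hlev
  · rcases le_total (f0 lam (X - A)) (f1 lam X) with h | h
    · rw [max_eq_right h] at hlev
      exact h_of_f1 hlev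
    · rw [max_eq_left h] at hlev
      rw [max_eq_left (by linarith)] at hK
      have hK2 := le_slopePotential (lam := lam) (X - A) (Real.exp_pos (lam - 1))
        (exp_sub_one_le_f0 h1.le (by linarith)) (f0_le_one lam (X - A))
      have hlog : Real.log (f0 lam (X - A)) ≤ X - A + lam - 1 :=
        (Real.log_le_iff_le_exp (f0_pos _ _)).2 (min_le_left _ _)
      have hK3 : f0 lam (X - A) ≤ slopePotential lam (Real.exp (lam - 1)) (X - A) := by
        -- Since `log (f0 lam D) ≤ lam + D - 1`, the second factor of the tested product is at least
        -- 1.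
        nlinarith [f0_pos lam (X - A)]
      have hK4 := mul_le_mul_of_nonneg_left hK3 hw
      have hr := mul_le_mul_of_nonneg_left (robustness_le h0 h1) hw
      linarith

/-- Weak duality, with dual values `α u` and `labLevel`; complementary slackness makes the dual
objective equal to the value of the algorithm. -/
lemma robustness_mul_value_le (ha : IsFractionalMatching I a) (h0 : 0 ≤ lam) (h1 : lam < 1)
    {y : U → Fin n → ℝ} (hy : IsFractionalMatching I y) :
    robustness lam * value I y ≤ value I (LAB lam U n I a) := by
  have hlam : lam ∈ Set.Icc (0 : ℝ) 1 := ⟨h0, h1.le⟩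
  set α : U → ℝ := fun u => ∑ v', (I.w u - labLevel lam I a v') * LAB lam U n I a u v' with hα
  have hα0 : ∀ u, 0 ≤ α u := fun u => Finset.sum_nonneg fun v _ => dual_nonneg ha h0 h1 u v
  calc robustness lam * value I y
      = ∑ u, ∑ v, robustness lam * I.w u * y u v := by
        simp only [value, Finset.mul_sum, mul_assoc]
    _ ≤ ∑ u, ∑ v, (α u * y u v + labLevel lam I a v * y u v) := by
        refine Finset.sum_le_sum fun u _ => Finset.sum_le_sum fun v _ => ?_
        by_cases h : I.E u v
        · rw [← add_mul]
          exact mul_le_mul_of_nonneg_right (robustness_mul_weight_le ha h0 h1 h) (hy.nonneg u v)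
        · simp [hy.off_edges u v h]
    _ = ∑ u, α u * ∑ v, y u v + ∑ v, labLevel lam I a v * ∑ u, y u v := by
        simp only [Finset.sum_add_distrib, Finset.mul_sum]
        rw [Finset.sum_comm (f := fun u v => labLevel lam I a v * y u v)]
    _ ≤ ∑ u, α u + ∑ v, labLevel lam I a v := by
        refine add_le_add (Finset.sum_le_sum fun u _ => ?_) (Finset.sum_le_sum fun v _ => ?_)
        · exact mul_le_of_le_one_right (hα0 u) (hy.offline_le u)
        · exact mul_le_of_le_one_right (labLevel_nonneg ha hlam v) (hy.online_le v)
    _ = value I (LAB lam U n I a) := by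
        simp only [hα, sub_mul, Finset.sum_sub_distrib, value]
        rw [Finset.sum_comm (f := fun u v => labLevel lam I a v * LAB lam U n I a u v)]
        simp only [← Finset.mul_sum, labLevel_mul_sum ha h0 h1]
        ring

end Guarantees

lemma LAB_isRobust {lam : ℝ} (hlam : lam ∈ Set.Icc (0 : ℝ) 1) :
    IsRobust.{u} (LAB lam) (robustness lam) := by
  refine ⟨robustness_mem hlam, fun U _ n I a ha => ?_⟩
  refine mul_opt_le (robustness_mem hlam).1 (value_nonneg (LAB_isFractionalMatching ha hlam))
    fun y hy => ?_
  rcases hlam.2.eq_or_lt with rfl | h1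
  · rw [robustness_one, zero_mul]
    exact value_nonneg (LAB_isFractionalMatching ha hlam)
  · exact robustness_mul_value_le ha hlam.1 h1 hy

lemma LAB_isConsistent {lam : ℝ} (hlam : lam ∈ Set.Icc (0 : ℝ) 1) :
    IsConsistent.{u} (LAB lam) (consistency lam) := by
  refine ⟨consistency_mem hlam, fun U _ n I a ha => ?_⟩
  rcases hlam.2.eq_or_lt with rfl | h1
  · rw [value_LAB_one ha]
    exact mul_le_of_le_one_left (value_nonneg ha) (consistency_mem hlam).2
  · exact consistency_mul_value_le ha hlam.1 h1

end OBM

end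

theorem theorem1 (lam : ℝ) (hlam : lam ∈ Set.Icc (0 : ℝ) 1) :
    OBM.LABWellDefined.{u} lam ∧
    OBM.IsOnlineMatchingAlgorithm.{u} (OBM.LAB lam) ∧
    OBM.IsRobust.{u} (OBM.LAB lam) (OBM.robustness lam) ∧
    OBM.IsConsistent.{u} (OBM.LAB lam) (OBM.consistency lam) :=
  ⟨OBM.LAB_wellDefined hlam, OBM.LAB_isOnline hlam, OBM.LAB_isRobust hlam,
    OBM.LAB_isConsistent hlam⟩
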